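/- Let $r\ge 1$. A solution of the $A_r$ $Q$-system in a field $K$ is a family $R_{\alpha,n}\in K$ ($0\le\alpha\le r+1$, $n\in\mathbb Z$) with $R_{0,n}=R_{r+1,n}=1$ and $$R_{\alpha,n+1}R_{\alpha,n-1}=R_{\alpha,n}^2+R_{\alpha+1,n}R_{\alpha-1,n}\qquad(1\le\alpha\le r,\ n\in\mathbb Z).$$ Let $\mathbf m=(m_1,\dots,m_r)\in\mathbb Z^r$ be a Motzkin path in the fundamental domain $\mathcal M_r$, i.e. $|m_\alpha-m_{\alpha+1}|\le 1$ for $1\le\alpha<r$ and $\min_\alpha m_\alpha=0$, and let $\mathbf x_{\mathbf m}=(R_{\alpha,m_\alpha},R_{\alpha,m_\alpha+1})_{1\le\alpha\le r}$ be the corresponding seed. *Weights.* Put $\lambda_{\alpha,n}=R_{\alpha,n+1}/R_{\alpha,n}$, $\mu_{\alpha,n}=R_{\alpha,n}/R_{\alpha-1,n}$ and $$y_{2\alpha-1}=\frac{\lambda_{\alpha,m_\alpha}}{\lambda_{\alpha-1,m_{\alpha-1}}}\quad(1\le\alpha\le r+1),\qquad y_{2\alpha}=\frac{\mu_{\alpha+1,m_\alpha+1}}{\mu_{\alpha,m_\alpha}}\,A_\alpha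 B_\alpha\quad(1\le\alpha\le r),$$ where $A_\alpha=\lambda_{\alpha+1,m_{\alpha+1}}/\lambda_{\alpha+1,m_\alpha}$ if $m_\alpha=m_{\alpha+1}+1$ and $A_\alpha=1$ otherwise, and $B_\alpha=\lambda_{\alpha-1,m_\alpha}/\lambda_{\alpha-1,m_{\alpha-1}}$ if $m_{\alpha-1}=m_\alpha+1$ and $B_\alpha=1$ otherwise (as $\lambda_{0,n}=\lambda_{r+1,n}=1$, the choice of $m_0,m_{r+1}$ is irrelevant). *The graph $\Gamma_{\mathbf m}$.* Let $v_1=1$, let $v_{\alpha+1}=v_\alpha+2$ if $m_{\alpha+1}=m_\alpha+1$ and $v_{\alpha+1}=v_\alpha+1$ otherwise ($1\le\alpha<r$), and let $v_{r+1}=v_r+2$. The vertices are $0,1,\dots,v_{r+1}$, with root $0$, and a vertex $v_\alpha'$ for each $2\le\alpha\le r$ with $m_\alpha\ne m_{\alpha-1}+1$. For $1\le\alpha\le r$ the skeleton edge number $2\alpha$ joins $v_\alpha$ to $v_\alpha+1$. For $1\le\alpha\le r+1$ the skeleton edge number $2\alpha-1$ joins $v_\alpha$ to $v_\alpha'$ if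 $2\le\alpha\le r$ and $m_\alpha\ne m_{\alpha-1}+1$, and joins $v_\alpha-1$ to $v_\alpha$ otherwise. Each skeleton edge $j$ carries two oriented edges: one pointing away from the root (from the first to the second vertex just named), of weight $1$, and one pointing down, towards the root, of weight $y_j$. Moreover, for all $1\le\alpha<\beta\le r$ with $m_{\gamma+1}=m_\gamma-1$ for $\alpha\le\gamma<\beta$, there is an extra down-pointing edge $v_\beta+1\to v_\alpha$ of weight $\prod_{\gamma=\alpha}^{\beta}y_{2\gamma}\big/\prod_{\gamma=\alpha+1}^{\beta}y_{2\gamma-1}$. Let $\mathcal Z^{\Gamma_{\mathbf m}}_{0,0}(n)$ be the sum, over all paths on $\Gamma_{\mathbf m}$ from the root to itself with exactly $n$ down-pointing steps, of the product of the weights of the traversed edges. **Theorem.** Let $\mathbf m\in\mathcal M_r$. 1. In the field of rational functions over $\mathbb Q$ in $2r$ indeterminates there is exactly one solution of the $Q$-system whose seed $\mathbf x_{\mathbf m}$ consists of the $2r$ indeterminates, and none of its members is $0$. (Its members are the functional forms $(R_{\alpha,n})_{\mathbf m}(\mathbf x_{\mathbf m})$ of the $R_{\alpha,n}$ in terms of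 the seed $\mathbf x_{\mathbf m}$.) 2. For each $n\ge 0$ there are finitely many paths on $\Gamma_{\mathbf m}$ from the root to itself with $n$ down-pointing steps, and the weight of every edge of $\Gamma_{\mathbf m}$ is a Laurent monomial in $\mathbf x_{\mathbf m}$ with coefficient $1$ (whose exponents depend only on $\mathbf m$ and the edge). 3. For each $n\ge0$, for every solution of the $Q$-system without zero members in any field (in particular for the one in 1), $$R_{1,n+m_1}=R_{1,m_1}\,\mathcal Z^{\Gamma_{\mathbf m}}_{0,0}(n),$$ and $R_{1,n+m_1}=P(\mathbf x_{\mathbf m})$ for a Laurent polynomial $P$ with non-negative integer coefficients that depends only on $\mathbf m$ and $n$. -/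

import Mathlib

namespace QSystem

/-! ### Motzkin paths -/

/-- `(m 1, …, m r)` is a Motzkin path lying in the fundamental domain
`{m | min_α m α = 0}`.  The values of `m` outside `{1, …, r}` play no role.
The last clause forces `1 ≤ r`. -/
structure InFundamentalDomain (r : ℕ) (m : ℕ → ℤ) : Prop where
  motzkin : ∀ α, 1 ≤ α → α + 1 ≤ r → |m α - m (α + 1)| ≤ 1
  nonneg : ∀ α, 1 ≤ α → α ≤ r → 0 ≤ m α
  attained : ∃ α, 1 ≤ α ∧ α ≤ r ∧ m α = 0

/-! ### The `A_r` `Q`-system and its seeds -/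

/-- `R α n` (`0 ≤ α ≤ r + 1`, `n ∈ ℤ`) solves the `A_r` `Q`-system. -/
structure IsSolution {K : Type*} [Field K] (r : ℕ) (R : ℕ → ℤ → K) : Prop where
  left : ∀ n, R 0 n = 1
  right : ∀ n, R (r + 1) n = 1
  rel : ∀ α, 1 ≤ α → α ≤ r → ∀ n,
    R α (n + 1) * R α (n - 1) = R α n ^ 2 + R (α + 1) n * R (α - 1) n

/-- No `R α n` vanishes, so that every mutation (division by `R α n`) makes sense. -/
def Nonvanishing {K : Type*} [Field K] (r : ℕ) (R : ℕ → ℤ → K) : Prop :=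
  ∀ α, 1 ≤ α → α ≤ r → ∀ n, R α n ≠ 0

/-- The seed `x_m`: entry `(a, i)` is `R_{α, m_α + i}` with `α = a + 1` and `i ∈ {0, 1}`. -/
def seed {K : Type*} (r : ℕ) (m : ℕ → ℤ) (R : ℕ → ℤ → K) (p : Fin r × Fin 2) : K :=
  R (p.1.val + 1) (m (p.1.val + 1) + (p.2.val : ℤ))

/-- The field of rational functions in `2 r` indeterminates. -/
abbrev SeedField (r : ℕ) : Type := FractionRing (MvPolynomial (Fin r × Fin 2) ℚ)

/-- The indeterminates of `SeedField r`. -/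
noncomputable def seedVar (r : ℕ) (p : Fin r × Fin 2) : SeedField r :=
  algebraMap (MvPolynomial (Fin r × Fin 2) ℚ) (SeedField r) (MvPolynomial.X p)

/-- The Laurent monomial `∏ x_p ^ (k p)`. -/
def laurentMonomial {K : Type*} [Field K] {r : ℕ} (x : Fin r × Fin 2 → K)
    (k : Fin r × Fin 2 → ℤ) : K :=
  ∏ p, x p ^ k p

/-- A Laurent polynomial in `2 r` variables with non-negative integer coefficients:
a finitely supported family of coefficients indexed by exponent vectors. -/
abbrev PosLaurent (r : ℕ) : Type := (Fin r × Fin 2 → ℤ) →₀ ℕ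

/-- The value of a Laurent polynomial at `x`. -/
noncomputable def PosLaurent.eval {K : Type*} [Field K] {r : ℕ} (P : PosLaurent r)
    (x : Fin r × Fin 2 → K) : K :=
  P.sum fun k c => (c : K) * laurentMonomial x k

/-! ### The graph `Γ_m` -/

/-- Vertex labels: `spine i` is the vertex `i`, `side i` is the univalent vertex `i'`
attached to `i` by a horizontal edge. -/
inductive Vertex : Type
  | spine (i : ℕ)
  | side (i : ℕ)

/-- Oriented edges.  Skeleton edges number `2α - 1` are called `odd α`, those
number `2α` are called `even α`; each of them carries two orientations, away from the root
(`Up`) and towards the root (`Down`).  `extra α β` are the additional down-pointing edges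
inside the descending segments. -/
inductive Edge : Type
  | oddUp (α : ℕ)
  | oddDown (α : ℕ)
  | evenUp (α : ℕ)
  | evenDown (α : ℕ)
  | extra (α β : ℕ)

/-- Label of the lower end of the skeleton edge `2α` (`1 ≤ α ≤ r`).
If `α` is the `j`-th element of its descending segment, this is the label in `Γ_m` of the vertex
`j` of the graph piece of that segment.  The label goes up by `1` from `α` to `α + 1` if the
step is descending or flat (where the connecting edge `2α + 1` is horizontal), and by `2` if
the step is ascending (where the connecting edge is vertical).  For `α = r + 1` it is
the upper end of the last skeleton edge `2r + 1`, which is vertical. -/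
def level (r : ℕ) (m : ℕ → ℤ) (α : ℕ) : ℕ :=
  α + ((Finset.Ico 1 α).filter fun β => β = r ∨ m (β + 1) = m β + 1).card

/-- The skeleton edge `2α - 1` is horizontal: all of them are except the first one, the
last one, and those that come from an ascending step `α - 1 → α`. -/
def Horizontal (r : ℕ) (m : ℕ → ℤ) (α : ℕ) : Prop :=
  2 ≤ α ∧ α ≤ r ∧ m α ≠ m (α - 1) + 1

instance (r : ℕ) (m : ℕ → ℤ) (α : ℕ) : Decidable (Horizontal r m α) :=
  inferInstanceAs (Decidable (_ ∧ _ ∧ _))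

/-- The end closer to the root of the skeleton edge `2α - 1`. -/
def oddNear (r : ℕ) (m : ℕ → ℤ) (α : ℕ) : Vertex :=
  if Horizontal r m α then .spine (level r m α) else .spine (level r m α - 1)

/-- The end farther from the root of the skeleton edge `2α - 1`. -/
def oddFar (r : ℕ) (m : ℕ → ℤ) (α : ℕ) : Vertex :=
  if Horizontal r m α then .side (level r m α) else .spine (level r m α)

/-- Starting point of an oriented edge. -/
def Edge.src (r : ℕ) (m : ℕ → ℤ) : Edge → Vertex
  | .oddUp α => oddNear r m α
  | .oddDown α => oddFar r m α
  | .evenUp α => .spine (level r m α)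
  | .evenDown α => .spine (level r m α + 1)
  | .extra _ β => .spine (level r m β + 1)

/-- End point of an oriented edge. -/
def Edge.tgt (r : ℕ) (m : ℕ → ℤ) : Edge → Vertex
  | .oddUp α => oddFar r m α
  | .oddDown α => oddNear r m α
  | .evenUp α => .spine (level r m α + 1)
  | .evenDown α => .spine (level r m α)
  | .extra α _ => .spine (level r m α)

/-- The oriented edges of `Γ_m`.  There is an extra edge for each pair `α < β` in the same
descending segment; for a segment `α_i, …, α_i + k - 1` these are the edges `a → b`,
`k + 1 ≥ a > b + 1 ≥ 2`, of its graph piece, with `α = α_i + b - 1`, `β = α_i + a - 2`.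
Distinct edges never share both starting point and end point, so a path on `Γ_m` may be
recorded by its edges instead of its vertices. -/
def IsEdge (r : ℕ) (m : ℕ → ℤ) : Edge → Prop
  | .oddUp α => 1 ≤ α ∧ α ≤ r + 1
  | .oddDown α => 1 ≤ α ∧ α ≤ r + 1
  | .evenUp α => 1 ≤ α ∧ α ≤ r
  | .evenDown α => 1 ≤ α ∧ α ≤ r
  | .extra α β => 1 ≤ α ∧ α < β ∧ β ≤ r ∧ ∀ γ, α ≤ γ → γ < β → m (γ + 1) = m γ - 1

/-- `1` for an edge pointing towards the root, `0` otherwise. -/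
def Edge.down : Edge → ℕ
  | .oddUp _ => 0
  | .oddDown _ => 1
  | .evenUp _ => 0
  | .evenDown _ => 1
  | .extra _ _ => 1

/-! ### The weights -/

section Weights

variable {K : Type*} [Field K]

/-- `λ_{α,n} = R_{α,n+1} / R_{α,n}`. -/
def lam (R : ℕ → ℤ → K) (α : ℕ) (n : ℤ) : K := R α (n + 1) / R α n

/-- `μ_{α,n} = R_{α,n} / R_{α-1,n}`, for `α ≥ 1`. -/
def mu (R : ℕ → ℤ → K) (α : ℕ) (n : ℤ) : K := R α n / R (α - 1) n

/-- The skeleton weight `y_{2α-1}(m)`, `1 ≤ α ≤ r + 1`. -/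
def yOdd (m : ℕ → ℤ) (R : ℕ → ℤ → K) (α : ℕ) : K :=
  lam R α (m α) / lam R (α - 1) (m (α - 1))

/-- The skeleton weight `y_{2α}(m)`, `1 ≤ α ≤ r`.  For `α = r` (resp. `α = 1`) the first
(resp. second) bracket is `1` in either case, since `λ_{r+1,n} = λ_{0,n} = 1`. -/
def yEven (m : ℕ → ℤ) (R : ℕ → ℤ → K) (α : ℕ) : K :=
  mu R (α + 1) (m α + 1) / mu R α (m α) *
    (if m α = m (α + 1) + 1 then lam R (α + 1) (m (α + 1)) / lam R (α + 1) (m α) else 1) *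
    (if m (α - 1) = m α + 1 then lam R (α - 1) (m α) / lam R (α - 1) (m (α - 1)) else 1)

/-- The weight of an oriented edge: `1` away from the root, `y` for the down-pointing
skeleton edges, and `∏_{b ≤ i < a} y_{i+1,i} / ∏_{b < i < a} y_{i',i}` for an extra edge
`a → b`. -/
def Edge.weight (m : ℕ → ℤ) (R : ℕ → ℤ → K) : Edge → K
  | .oddUp _ => 1
  | .oddDown α => yOdd m R α
  | .evenUp _ => 1
  | .evenDown α => yEven m R α
  | .extra α β => (∏ γ ∈ Finset.Icc α β, yEven m R γ) / ∏ γ ∈ Finset.Ioc α β, yOdd m R γ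

end Weights

/-! ### Paths -/

/-- The list of edges `l` is a path on `Γ_m` from `a` to `b`. -/
def IsPath (r : ℕ) (m : ℕ → ℤ) : Vertex → List Edge → Vertex → Prop
  | a, [], b => a = b
  | a, e :: l, b => IsEdge r m e ∧ e.src r m = a ∧ IsPath r m (e.tgt r m) l b

/-- Paths on `Γ_m` from the root `0` to itself with `n` down-pointing steps. -/
def rootPaths (r : ℕ) (m : ℕ → ℤ) (n : ℕ) : Set (List Edge) :=
  {l | IsPath r m (.spine 0) l (.spine 0) ∧ (l.map Edge.down).sum = n}

/-- The partition function `Z_{0,0}^{Γ_m}(n)` of the weighted paths in `rootPaths r m n`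
(a finite set). -/
noncomputable def pathZ {K : Type*} [Field K] (r : ℕ) (m : ℕ → ℤ) (R : ℕ → ℤ → K) (n : ℕ) : K :=
  ∑ᶠ l ∈ rootPaths r m n, (l.map (Edge.weight m R)).prod

end QSystem

/-!
Let `L` be the linear functional `x ^ k ↦ R 1 k` on Laurent polynomials. The `Q`-system says that
`λ_{α,n}` and `μ_{α+1,n+1} / μ_{α,n}` are the coefficients in the recurrences between monic
polynomials of degree `α` that are orthogonal to `α` consecutive powers of `x` with respect to `L`.
Hence the moments of these polynomials satisfy three-term relations in `(α, n)` and vanish in a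
window of exponents. Along a Motzkin path these relations coincide with the relations that the
first step imposes on the sums over paths on `Γ_m` that start at a given skeleton vertex and end at
the root, where the extra edges account for the descending segments of `m`. The sums over paths
from the root are thus the moments `R 1 (n + m 1)` up to the factor `R 1 (m 1)`.

Laurent positivity follows since every edge weight is a Laurent monomial in the seed: a member of
`R` that does not belong to the seed could only enter at a descending step, where the factors `A`
and `B` cancel it.
-/

namespace QSystem

/-! ### Moments -/

section Moments

variable {K : Type*} [Field K] {r : ℕ} {R : ℕ → ℤ → K}

theorem IsSolution.ne_zero (hR : IsSolution r R) (hn : Nonvanishing r R) {α : ℕ}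
    (hα : α ≤ r + 1) (n : ℤ) : R α n ≠ 0 := by
  obtain rfl | rfl | ⟨h1, h2⟩ : α = 0 ∨ α = r + 1 ∨ 1 ≤ α ∧ α ≤ r := by omega
  · simp [hR.left]
  · simp [hR.right]
  · exact hn α h1 h2 n

theorem IsSolution.lam_ne_zero (hR : IsSolution r R) (hn : Nonvanishing r R) {α : ℕ}
    (hα : α ≤ r + 1) (n : ℤ) : lam R α n ≠ 0 :=
  div_ne_zero (hR.ne_zero hn hα _) (hR.ne_zero hn hα _)

theorem IsSolution.lam_left (hR : IsSolution r R) (n : ℤ) : lam R 0 n = 1 := by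
  simp [lam, hR.left]

theorem IsSolution.lam_right (hR : IsSolution r R) (n : ℤ) : lam R (r + 1) n = 1 := by
  simp [lam, hR.right]

theorem IsSolution.mu_div_mu_eq_sub_div (hR : IsSolution r R) (hn : Nonvanishing r R) {a : ℕ}
    (ha : a + 1 ≤ r) (n : ℤ) : mu R (a + 2) (n + 1) / mu R (a + 1) n =
      (lam R (a + 1) (n + 1) - lam R (a + 1) n) / lam R a n := by
  have h0 := hR.ne_zero hn (α := a) (by omega)
  have h1 := hR.ne_zero hn (α := a + 1) (by omega)
  have hrel := hR.rel (a + 1) (by omega) ha (n + 1)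
  have := h0 n; have := h0 (n + 1); have := h1 n; have := h1 (n + 1)
  simp only [mu, lam, Nat.add_sub_cancel, add_sub_cancel_right,
    show a + 2 - 1 = a + 1 from rfl] at hrel ⊢
  field_simp
  linear_combination -hrel

theorem IsSolution.mu_div_mu_eq_mul_inv_sub_inv (hR : IsSolution r R) (hn : Nonvanishing r R)
    {a : ℕ} (ha : a + 1 ≤ r) (n : ℤ) : mu R (a + 2) (n + 1) / mu R (a + 1) n =
      lam R (a + 2) n * ((lam R (a + 1) (n - 1))⁻¹ - (lam R (a + 1) n)⁻¹) := by
  have h1 := hR.ne_zero hn (α := a + 1) (by omega)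
  have h2 := hR.ne_zero hn (α := a + 2) (by omega)
  have hrel := hR.rel (a + 1) (by omega) ha n
  have := h1 n; have := h1 (n + 1); have := h2 n
  simp only [mu, lam, Nat.add_sub_cancel, sub_add_cancel,
    show a + 2 - 1 = a + 1 from rfl] at hrel ⊢
  field_simp
  linear_combination -R (a + 2) (n + 1) * hrel

/-- If `L` is the linear functional `x ^ k ↦ R 1 k` on Laurent polynomials, then `moment R a n k`
is `L (x ^ k * p)`, where `p` is the monic polynomial of degree `a` in `x` such that
`L (x ^ j * p) = 0` for `n - a < j ≤ n`. -/
def moment (R : ℕ → ℤ → K) : ℕ → ℤ → ℤ → K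
  | 0, _, k => R 1 k
  | a + 1, n, k =>
    moment R a n (k + 1) - lam R (a + 1) n / lam R a (n - 1) * moment R a (n - 1) k

theorem moment_zero (n k : ℤ) : moment R 0 n k = R 1 k := rfl

theorem moment_succ (a : ℕ) (n k : ℤ) : moment R (a + 1) n k =
    moment R a n (k + 1) - lam R (a + 1) n / lam R a (n - 1) * moment R a (n - 1) k := rfl

theorem moment_succ_add_one (a : ℕ) (n k : ℤ) : moment R (a + 1) (n + 1) k =
    moment R a (n + 1) (k + 1) - lam R (a + 1) (n + 1) / lam R a n * moment R a n k := by
  rw [moment_succ, add_sub_cancel_right]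

theorem IsSolution.moment_succ_eq (hR : IsSolution r R) (hn : Nonvanishing r R) {a : ℕ}
    (ha : a ≤ r) (n k : ℤ) : moment R (a + 1) n k =
      moment R a (n + 1) (k + 1) - lam R (a + 1) n / lam R a n * moment R a n k := by
  induction a generalizing n k with
  | zero => simp only [moment_succ, moment_zero, hR.lam_left]
  | succ a ih =>
    have hlam := hR.lam_ne_zero hn (α := a + 1) (by omega)
    have hdrop : moment R (a + 1) n (k + 1) - moment R (a + 1) (n + 1) (k + 1) =
        mu R (a + 2) (n + 1) / mu R (a + 1) n * moment R a n (k + 1) := by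
      rw [hR.mu_div_mu_eq_sub_div hn ha, ih (by omega), moment_succ_add_one]
      ring
    have hratio : moment R (a + 1) (n - 1) k / lam R (a + 1) (n - 1) -
        moment R (a + 1) n k / lam R (a + 1) n =
        ((lam R (a + 1) (n - 1))⁻¹ - (lam R (a + 1) n)⁻¹) * moment R a n (k + 1) := by
      have := hlam n; have := hlam (n - 1)
      rw [ih (by omega), moment_succ, sub_add_cancel]
      field_simp
      ring
    rw [hR.mu_div_mu_eq_mul_inv_sub_inv hn ha] at hdrop
    rw [moment_succ]
    linear_combination hdrop - lam R (a + 2) n * hratio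

theorem IsSolution.moment_sub_moment_add_one (hR : IsSolution r R) (hn : Nonvanishing r R) {a : ℕ}
    (ha : a + 1 ≤ r) (n k : ℤ) : moment R (a + 1) n k - moment R (a + 1) (n + 1) k =
      mu R (a + 2) (n + 1) / mu R (a + 1) n * moment R a n k := by
  rw [hR.mu_div_mu_eq_sub_div hn ha, hR.moment_succ_eq hn (by omega), moment_succ_add_one]
  ring

theorem IsSolution.moment_add_one_right (hR : IsSolution r R) (hn : Nonvanishing r R) {a : ℕ}
    (ha : a ≤ r) (n : ℤ) : moment R a n (n + 1) = R (a + 1) (n + 1) / R a n := by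
  induction a generalizing n with
  | zero => simp [moment_zero, hR.left]
  | succ a ih =>
    have h0 := hR.ne_zero hn (α := a) (by omega)
    have h1 := hR.ne_zero hn (α := a + 1) (by omega)
    have hvanish : moment R (a + 1) (n + 1) (n + 1) = 0 := by
      have := h0 n; have := h0 (n + 1); have := h1 (n + 1)
      rw [moment_succ_add_one, ih (by omega), ih (by omega), lam, lam]
      field_simp
      ring
    have hdrop := hR.moment_sub_moment_add_one hn ha n (n + 1)
    have := h0 n; have := h1 n; have := h1 (n + 1)
    rw [hvanish, sub_zero, ih (by omega), mu, mu, Nat.add_sub_cancel,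
      show a + 2 - 1 = a + 1 from rfl] at hdrop
    rw [hdrop]
    field_simp

theorem IsSolution.moment_self (hR : IsSolution r R) (hn : Nonvanishing r R) {a : ℕ}
    (ha : a ≤ r) (n : ℤ) : moment R (a + 1) n n = 0 := by
  have h0 := hR.ne_zero hn (α := a) (by omega)
  have h1 := hR.ne_zero hn (α := a + 1) (by omega) n
  have hprev := hR.moment_add_one_right hn ha (n - 1)
  have := h0 n; have := h0 (n - 1)
  rw [sub_add_cancel] at hprev
  rw [moment_succ, hR.moment_add_one_right hn ha, hprev, lam, lam, sub_add_cancel]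
  field_simp
  ring

theorem IsSolution.moment_eq_zero (hR : IsSolution r R) (hn : Nonvanishing r R) {a : ℕ}
    (ha : a ≤ r + 1) {n k : ℤ} (hlt : n - a < k) (hle : k ≤ n) : moment R a n k = 0 := by
  induction a generalizing n k with
  | zero => push_cast at hlt; omega
  | succ a ih =>
    push_cast at hlt
    rcases hle.eq_or_lt with rfl | hle
    · exact hR.moment_self hn (by omega) k
    · rw [moment_succ, ih (by omega) (by omega) (by omega), ih (by omega) (by omega) (by omega)]
      simp

theorem IsSolution.moment_top (hR : IsSolution r R) (hn : Nonvanishing r R) (n k : ℤ) :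
    moment R (r + 1) n k = 0 := by
  have hperiodic : Function.Periodic (fun n => moment R (r + 1) n k) 1 := fun n => by
    simp only [hR.moment_succ_eq hn le_rfl n, moment_succ_add_one, hR.lam_right]
  have hconst := hperiodic.int_mul (n - k) k
  simp only [Int.cast_id, mul_one, add_sub_cancel] at hconst
  rw [hconst, hR.moment_self hn le_rfl]

end Moments

/-! ### Path sums on the graph -/

section Graph

variable {r : ℕ} {m : ℕ → ℤ}

theorem level_strictMono (r : ℕ) (m : ℕ → ℤ) : StrictMono (level r m) := fun _ _ h =>
  add_lt_add_of_lt_of_le h <| Finset.card_le_card <| Finset.filter_subset_filter _ <|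
    Finset.Ico_subset_Ico_right h.le

theorem level_succ {α : ℕ} (h1 : 1 ≤ α) (hr : α ≤ r) :
    level r m (α + 1) = level r m α + if Horizontal r m (α + 1) then 1 else 2 := by
  have hiff : Horizontal r m (α + 1) ↔ ¬(α = r ∨ m (α + 1) = m α + 1) := by
    rw [Horizontal, Nat.add_sub_cancel]
    omega
  rw [level, level, Nat.Ico_succ_right_eq_insert_Ico h1, Finset.filter_insert]
  by_cases h : α = r ∨ m (α + 1) = m α + 1
  · rw [if_pos h, if_neg (by tauto), Finset.card_insert_of_notMem (by simp)]
    omega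
  · rw [if_neg h, if_pos (by tauto)]
    omega

theorem oddNear_one : oddNear r m 1 = .spine 0 := by
  simp [oddNear, Horizontal, level]

theorem oddNear_succ {α : ℕ} (h1 : 1 ≤ α) (hr : α ≤ r) :
    oddNear r m (α + 1) = .spine (level r m α + 1) := by
  rw [oddNear, level_succ h1 hr]
  split_ifs <;> rfl

theorem spine_level (α : ℕ) :
    .spine (level r m α) = if Horizontal r m α then oddNear r m α else oddFar r m α := by
  simp only [oddNear, oddFar]
  split_ifs <;> rfl

theorem oddFar_injective : Function.Injective (oddFar r m) := fun α β h => by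
  simp only [oddFar] at h
  split_ifs at h <;> simpa [(level_strictMono r m).injective.eq_iff] using h

theorem oddNear_succ_ne_oddFar {α β : ℕ} (hα : α ≤ r) (hβ : 1 ≤ β) :
    oddNear r m (α + 1) ≠ oddFar r m β := by
  have hpos : 0 < level r m β := by simp only [level]; omega
  rcases Nat.eq_zero_or_pos α with rfl | h1
  · simp only [zero_add, oddNear_one, oddFar]
    split_ifs <;> simp [hpos.ne]
  rw [oddNear_succ h1 hα, oddFar]
  split_ifs with h
  · simp
  · simp only [ne_eq, Vertex.spine.injEq]
    intro heq
    have hle := (level_strictMono r m).monotone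
      ((level_strictMono r m).lt_iff_lt.1 (show level r m α < level r m β by omega))
    rw [Nat.succ_eq_add_one, level_succ h1 hα] at hle
    split_ifs at hle with hα'
    · have : level r m (α + 1) = level r m β := by rw [level_succ h1 hα, if_pos hα', heq]
      exact h ((level_strictMono r m).injective this ▸ hα')
    · omega

theorem oddNear_injOn : Set.InjOn (fun α => oddNear r m (α + 1)) (Set.Iic r) := by
  intro α hα β hβ h
  rcases Nat.eq_zero_or_pos α with rfl | h1 <;> rcases Nat.eq_zero_or_pos β with rfl | h2
  · rfl
  · simp [oddNear_one, oddNear_succ h2 hβ] at h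
  · simp [oddNear_one, oddNear_succ h1 hα] at h
  · simpa [oddNear_succ h1 hα, oddNear_succ h2 hβ, (level_strictMono r m).injective.eq_iff] using h

theorem isEdge_and_src_eq_oddFar_iff {e : Edge} {α : ℕ} (h1 : 1 ≤ α) (hr : α ≤ r + 1) :
    IsEdge r m e ∧ e.src r m = oddFar r m α ↔
      e = .oddDown α ∨ e = .evenUp α ∧ ¬Horizontal r m α ∧ α ≤ r := by
  have hne {β} (hβ : β ≤ r) := oddNear_succ_ne_oddFar (m := m) hβ h1
  cases e with
  | oddUp β =>
    simp only [IsEdge, Edge.src, reduceCtorEq, false_and, or_self, iff_false, not_and]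
    intro ⟨h, h'⟩
    obtain ⟨β, rfl⟩ := Nat.exists_eq_add_of_le' h
    exact hne (by omega)
  | oddDown β =>
    simp only [IsEdge, Edge.src, oddFar_injective.eq_iff, Edge.oddDown.injEq, reduceCtorEq,
      false_and, or_false]
    omega
  | evenUp β =>
    simp only [IsEdge, Edge.src, spine_level, Edge.evenUp.injEq, reduceCtorEq, false_or]
    split_ifs with h
    · have := fun h1 : 1 ≤ β => hne (β := β - 1)
      grind
    · rw [oddFar_injective.eq_iff]
      grind
  | evenDown β | extra _ β =>
    simp only [IsEdge, Edge.src, reduceCtorEq, false_and, or_self, iff_false, not_and]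
    intro h
    rw [← oddNear_succ (by omega) (by omega)]
    exact hne (by omega)

theorem isEdge_and_src_eq_oddNear_succ_iff {e : Edge} {α : ℕ} (hα : α ≤ r) :
    IsEdge r m e ∧ e.src r m = oddNear r m (α + 1) ↔
      e = .oddUp (α + 1) ∨ e = .evenUp (α + 1) ∧ Horizontal r m (α + 1) ∨
        IsEdge r m e ∧ (e = .evenDown α ∨ ∃ γ, e = .extra γ α) := by
  have hne {β} (hβ : 1 ≤ β) := (oddNear_succ_ne_oddFar (m := m) hα hβ).symm
  have hinj {β} (hβ : β ≤ r) : oddNear r m (β + 1) = oddNear r m (α + 1) ↔ β = α :=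
    oddNear_injOn.eq_iff hβ hα
  cases e with
  | oddUp β =>
    rcases β with - | β
    · simp [IsEdge]
    · simp only [IsEdge, Edge.src, Edge.oddUp.injEq, reduceCtorEq, false_and, exists_const,
        or_self, and_false, or_false]
      grind
  | oddDown β =>
    simp only [IsEdge, Edge.src, reduceCtorEq, false_and, exists_const, or_self, and_false,
      iff_false, not_and]
    exact fun h => hne h.1
  | evenUp β =>
    simp only [IsEdge, Edge.src, spine_level, Edge.evenUp.injEq, reduceCtorEq, exists_const,
      or_self, and_false, or_false, false_or]
    rcases β with - | β
    · simp
    split_ifs with h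
    · have := h.2.1
      grind
    · grind
  | evenDown β =>
    simp only [IsEdge, Edge.src, Edge.evenDown.injEq, reduceCtorEq, exists_const, or_false,
      false_and, false_or]
    refine and_congr_right fun h => ?_
    rw [← oddNear_succ h.1 h.2, hinj h.2]
  | extra γ β =>
    simp only [IsEdge, Edge.src, Edge.extra.injEq, reduceCtorEq, exists_eq_left', false_and,
      false_or]
    refine and_congr_right fun h => ?_
    rw [← oddNear_succ (by omega) h.2.2.1, hinj h.2.2.1]

theorem finite_isEdge (r : ℕ) (m : ℕ → ℤ) : {e | IsEdge r m e}.Finite := by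
  have hs := Set.finite_Iic (r + 1)
  refine (((hs.image Edge.oddUp).union (hs.image Edge.oddDown)).union
    (((hs.image Edge.evenUp).union (hs.image Edge.evenDown)).union
      (hs.image2 Edge.extra hs))).subset fun e he => ?_
  cases e <;> simp only [Set.mem_ofPred_eq, IsEdge] at he <;> grind

/-- Distance to the root along the skeleton. -/
def Vertex.height : Vertex → ℕ
  | spine i => i
  | side i => i + 1

theorem height_oddNear_add_one {α : ℕ} (h1 : 1 ≤ α) :
    (oddNear r m α).height + 1 = (oddFar r m α).height := by
  have hpos : 1 ≤ level r m α := by simp only [level]; omega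
  simp only [oddNear, oddFar]
  split_ifs <;> simp [Vertex.height, hpos]

theorem height_oddFar_le {α : ℕ} (hα : α ≤ r + 1) :
    (oddFar r m α).height ≤ level r m (r + 1) := by
  have hmono := level_strictMono r m
  rw [oddFar]
  split_ifs with h
  · exact hmono (Nat.lt_succ_of_le h.2.1)
  · exact hmono.monotone hα

theorem height_src_lt {e : Edge} (he : IsEdge r m e) :
    (e.src r m).height < (e.tgt r m).height + e.down * (level r m (r + 1) + 1) := by
  have hlt {α} (hα : α ≤ r) : level r m α < level r m (r + 1) :=
    level_strictMono r m (Nat.lt_succ_of_le hα)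
  cases e with
  | oddUp α =>
    simp only [Edge.src, Edge.tgt, Edge.down, ← height_oddNear_add_one he.1]
    omega
  | oddDown α =>
    have := height_oddFar_le (m := m) he.2
    simp only [Edge.src, Edge.tgt, Edge.down]
    omega
  | evenUp α =>
    simp only [Edge.src, Edge.tgt, Edge.down, Vertex.height]
    omega
  | evenDown α =>
    have := hlt he.2
    simp only [Edge.src, Edge.tgt, Edge.down, Vertex.height]
    omega
  | extra α β =>
    have := hlt he.2.2.1
    simp only [Edge.src, Edge.tgt, Edge.down, Vertex.height]
    omega

/-- Paths on `Γ_m` from `v` to the root with `n` down-pointing steps. -/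
def pathsToRoot (r : ℕ) (m : ℕ → ℤ) (v : Vertex) (n : ℕ) : Set (List Edge) :=
  {l | IsPath r m v l (.spine 0) ∧ (l.map Edge.down).sum = n}

theorem IsPath.isEdge {l : List Edge} {a b : Vertex} (h : IsPath r m a l b) :
    ∀ e ∈ l, IsEdge r m e := by
  induction l generalizing a with
  | nil => simp
  | cons e l ih => exact List.forall_mem_cons.2 ⟨h.1, ih h.2.2⟩

theorem IsPath.length_add_height_le {l : List Edge} {v : Vertex}
    (h : IsPath r m v l (.spine 0)) :
    l.length + v.height ≤ (l.map Edge.down).sum * (level r m (r + 1) + 1) := by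
  induction l generalizing v with
  | nil => simp [show v = .spine 0 from h, Vertex.height]
  | cons e l ih =>
    obtain ⟨he, rfl, hl⟩ := h
    have := height_src_lt he
    have := ih hl
    simp only [List.length_cons, List.map_cons, List.sum_cons, add_mul]
    omega

theorem finite_pathsToRoot (r : ℕ) (m : ℕ → ℤ) (v : Vertex) (n : ℕ) :
    (pathsToRoot r m v n).Finite := by
  have : Finite {e // IsEdge r m e} := finite_isEdge r m
  refine ((List.finite_length_le {e // IsEdge r m e} (n * (level r m (r + 1) + 1))).image
    (List.map Subtype.val)).subset fun l ⟨hl, hn⟩ => ?_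
  have hlen := hl.length_add_height_le
  rw [hn] at hlen
  lift l to List {e // IsEdge r m e} using hl.isEdge
  rw [List.length_map] at hlen
  exact ⟨l, le_of_add_le_left hlen, rfl⟩

theorem pathsToRoot_zero {v : Vertex} :
    pathsToRoot r m v 0 = {l | l = [] ∧ v = .spine 0} := by
  ext l
  constructor
  · rintro ⟨hl, hn⟩
    have hlen := hl.length_add_height_le
    rw [hn, zero_mul, Nat.le_zero, add_eq_zero, List.length_eq_zero_iff] at hlen
    obtain ⟨rfl, -⟩ := hlen
    exact ⟨rfl, hl⟩
  · rintro ⟨rfl, hv⟩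
    exact ⟨hv, rfl⟩

variable {K : Type*} [Field K]

/-- The partition function of the paths from `v` to the root with `n` down-pointing steps. -/
noncomputable def pathSum (r : ℕ) (m : ℕ → ℤ) (R : ℕ → ℤ → K) (v : Vertex) (n : ℕ) : K :=
  ∑ᶠ l ∈ pathsToRoot r m v n, (l.map (Edge.weight m R)).prod

theorem pathSum_zero (R : ℕ → ℤ → K) (v : Vertex) [Decidable (v = .spine 0)] :
    pathSum r m R v 0 = if v = .spine 0 then 1 else 0 := by
  rw [pathSum, pathsToRoot_zero]
  split_ifs with hv <;> simp [hv]

theorem pathSum_succ (R : ℕ → ℤ → K) {v : Vertex} {out : Finset Edge}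
    (hout : ∀ e, e ∈ out ↔ IsEdge r m e ∧ e.src r m = v) (n : ℕ) :
    pathSum r m R v (n + 1) =
      ∑ e ∈ out, e.weight m R * pathSum r m R (e.tgt r m) (n + 1 - e.down) := by
  have hcons : pathsToRoot r m v (n + 1) = ⋃ e ∈ (out : Set Edge),
      (e :: ·) '' pathsToRoot r m (e.tgt r m) (n + 1 - e.down) := by
    ext l
    cases l with
    | nil => simp [pathsToRoot]
    | cons e l =>
      have hdown : e.down ≤ 1 := by cases e <;> simp [Edge.down]
      simp only [pathsToRoot, Set.mem_ofPred_eq, IsPath, List.map_cons, List.sum_cons,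
        Finset.mem_coe, Set.mem_iUnion, Set.mem_image, List.cons.injEq, exists_prop]
      grind
  rw [pathSum, hcons, finsum_mem_biUnion _ out.finite_toSet
    fun e _ => (finite_pathsToRoot r m _ _).image _, finsum_mem_coe_finset]
  · refine Finset.sum_congr rfl fun e _ => ?_
    rw [finsum_mem_image List.cons_injective.injOn, pathSum, mul_finsum_mem]
    simp only [List.map_cons, List.prod_cons]
  · intro e _ e' _ hne
    refine Set.disjoint_left.2 ?_
    rintro _ ⟨l, -, rfl⟩ ⟨l', -, h⟩
    exact hne (List.cons.inj h).1.symm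

theorem pathSum_oddFar_succ (R : ℕ → ℤ → K) {α : ℕ} (h1 : 1 ≤ α) (hα : α ≤ r + 1) (n : ℕ) :
    pathSum r m R (oddFar r m α) (n + 1) =
      yOdd m R α * pathSum r m R (oddNear r m α) n +
        if ¬Horizontal r m α ∧ α ≤ r then pathSum r m R (oddNear r m (α + 1)) (n + 1) else 0 := by
  classical
  rw [pathSum_succ R (out := insert (.oddDown α)
    (if ¬Horizontal r m α ∧ α ≤ r then {.evenUp α} else ∅)), Finset.sum_insert]
  · congr 1
    split_ifs with h
    · simp [Edge.weight, Edge.tgt, Edge.down, oddNear_succ h1 h.2]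
    · simp
  · split_ifs <;> simp
  · intro e
    rw [isEdge_and_src_eq_oddFar_iff h1 hα]
    split_ifs with h <;> simp [h]

/-- The lower ends `γ` of the down-pointing edges that start at the upper end of the skeleton edge
`2 α`: the beginning, up to `α`, of the descending segment of `α`. -/
noncomputable def descendants (m : ℕ → ℤ) (α : ℕ) : Finset ℕ :=
  open Classical in {γ ∈ Finset.Icc 1 α | ∀ β, γ ≤ β → β < α → m (β + 1) = m β - 1}

theorem mem_descendants {α γ : ℕ} : γ ∈ descendants m α ↔
    (1 ≤ γ ∧ γ ≤ α) ∧ ∀ β, γ ≤ β → β < α → m (β + 1) = m β - 1 := by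
  simp [descendants]

/-- The weighted sum over the down-pointing edges that start at the upper end of the skeleton edge
`2 α`.  Formally `extra α α` has the weight of `evenDown α`. -/
noncomputable def descentSum (m : ℕ → ℤ) (R : ℕ → ℤ → K) (f : ℕ → K) (α : ℕ) : K :=
  ∑ γ ∈ descendants m α, Edge.weight m R (.extra γ α) * f γ

theorem weight_extra_self (R : ℕ → ℤ → K) (α : ℕ) :
    Edge.weight m R (.extra α α) = yEven m R α := by
  simp [Edge.weight]

/-- The down-pointing edge to the lower end of the skeleton edge `2 γ` from the upper end of the
skeleton edge `2 α`. -/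
def descentEdge (α : ℕ) : ℕ ↪ Edge where
  toFun γ := if γ = α then .evenDown α else .extra γ α
  inj' γ γ' h := by grind

theorem descentEdge_self (α : ℕ) : descentEdge α α = .evenDown α := if_pos rfl

theorem descentEdge_of_ne {α γ : ℕ} (h : γ ≠ α) : descentEdge α γ = .extra γ α := if_neg h

theorem mem_map_descentEdge {α : ℕ} (hα : α ≤ r) {e : Edge} :
    e ∈ (descendants m α).map (descentEdge α) ↔
      IsEdge r m e ∧ (e = .evenDown α ∨ ∃ γ, e = .extra γ α) := by
  simp only [Finset.mem_map, mem_descendants]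
  constructor
  · rintro ⟨γ, ⟨⟨h1, hγ⟩, hdesc⟩, rfl⟩
    rcases hγ.eq_or_lt with rfl | hγ
    · rw [descentEdge_self]
      exact ⟨⟨h1, hα⟩, .inl rfl⟩
    · rw [descentEdge_of_ne hγ.ne]
      exact ⟨⟨h1, hγ, hα, hdesc⟩, .inr ⟨γ, rfl⟩⟩
  · rintro ⟨he, rfl | ⟨γ, rfl⟩⟩
    · exact ⟨α, ⟨⟨he.1, le_rfl⟩, by omega⟩, descentEdge_self α⟩
    · exact ⟨γ, ⟨⟨he.1, he.2.1.le⟩, he.2.2.2⟩, descentEdge_of_ne he.2.1.ne⟩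

theorem sum_map_descentEdge (R : ℕ → ℤ → K) (α n : ℕ) :
    ∑ e ∈ (descendants m α).map (descentEdge α),
        e.weight m R * pathSum r m R (e.tgt r m) (n + 1 - e.down) =
      descentSum m R (fun γ => pathSum r m R (.spine (level r m γ)) n) α := by
  rw [Finset.sum_map, descentSum]
  refine Finset.sum_congr rfl fun γ _ => ?_
  rcases eq_or_ne γ α with rfl | h
  · rw [descentEdge_self, weight_extra_self]
    rfl
  · rw [descentEdge_of_ne h]
    rfl

theorem pathSum_oddNear_succ_succ (R : ℕ → ℤ → K) {α : ℕ} (hα : α ≤ r) (n : ℕ) :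
    pathSum r m R (oddNear r m (α + 1)) (n + 1) =
      (if α < r then pathSum r m R (oddNear r m (α + 2)) (n + 1) else 0) +
        yOdd m R (α + 1) * pathSum r m R (oddNear r m (α + 1)) n +
        descentSum m R (fun γ => pathSum r m R (.spine (level r m γ)) n) α := by
  classical
  have hdisj : Disjoint (if Horizontal r m (α + 1) then {Edge.evenUp (α + 1)} else ∅)
      ((descendants m α).map (descentEdge α)) := by
    refine Finset.disjoint_left.2 fun e he he' => ?_
    rw [mem_map_descentEdge hα] at he'
    split_ifs at he <;> simp_all
  rw [pathSum_succ R (out := insert (.oddUp (α + 1))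
    ((if Horizontal r m (α + 1) then {.evenUp (α + 1)} else ∅) ∪
      (descendants m α).map (descentEdge α))), Finset.sum_insert, Finset.sum_union hdisj,
    sum_map_descentEdge]
  · simp only [Edge.weight, Edge.tgt, Edge.down, one_mul, tsub_zero,
      pathSum_oddFar_succ R (Nat.le_add_left 1 α) (Nat.succ_le_succ hα)]
    by_cases h : Horizontal r m (α + 1)
    · have hlt : α < r := h.2.1
      simp only [h, not_true_eq_false, Order.add_one_le_iff, hlt, and_true, if_false, if_true,
        add_zero, Finset.sum_singleton, tsub_zero, one_mul,
        oddNear_succ (Nat.le_add_left 1 α) hlt]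
      ring
    · simp only [h, not_false_eq_true, Order.add_one_le_iff, true_and, if_false,
        Finset.sum_empty, zero_add]
      ring
  · rw [Finset.mem_union, mem_map_descentEdge hα]
    split_ifs <;> simp
  · intro e
    rw [isEdge_and_src_eq_oddNear_succ_iff hα, Finset.mem_insert, Finset.mem_union,
      mem_map_descentEdge hα]
    split_ifs with h <;> simp [h]

theorem descendants_zero : descendants m 0 = ∅ := by
  simp [descendants]

theorem descendants_succ (m : ℕ → ℤ) (α : ℕ) : descendants m (α + 1) =
    insert (α + 1) (if m (α + 1) = m α - 1 then descendants m α else ∅) := by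
  ext γ
  split_ifs with h <;> simp only [mem_descendants, Finset.mem_insert, Finset.notMem_empty] <;> grind

theorem weight_extra_succ (R : ℕ → ℤ → K) {γ α : ℕ} (h : γ ≤ α) :
    Edge.weight m R (.extra γ (α + 1)) =
      yEven m R (α + 1) / yOdd m R (α + 1) * Edge.weight m R (.extra γ α) := by
  rw [Edge.weight, Edge.weight, Finset.prod_Icc_succ_top (by omega),
    Finset.prod_Ioc_succ_top h, mul_comm (∏ _ ∈ _, yEven m R _), mul_comm (∏ _ ∈ _, yOdd m R _),
    mul_div_mul_comm]

theorem descentSum_succ (R : ℕ → ℤ → K) (f : ℕ → K) (α : ℕ) :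
    descentSum m R f (α + 1) = yEven m R (α + 1) * (f (α + 1) +
      if m (α + 1) = m α - 1 then descentSum m R f α / yOdd m R (α + 1) else 0) := by
  rw [descentSum, descendants_succ, Finset.sum_insert, weight_extra_self, mul_add]
  · congr 1
    split_ifs with h
    · rw [descentSum, Finset.sum_div, Finset.mul_sum]
      refine Finset.sum_congr rfl fun γ hγ => ?_
      rw [weight_extra_succ R (mem_descendants.1 hγ).1.2]
      ring
    · simp
  · split_ifs <;> simp [mem_descendants]

end Graph

/-! ### The path formula -/

/-- `(m 1, …, m r)` is a Motzkin path, with no normalization of its minimum. -/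
def IsMotzkinPath (r : ℕ) (m : ℕ → ℤ) : Prop :=
  ∀ α, 1 ≤ α → α + 1 ≤ r → |m α - m (α + 1)| ≤ 1

section PathFormula

variable {K : Type*} [Field K] {r : ℕ} {m : ℕ → ℤ} {R : ℕ → ℤ → K}

/-- The factor `A_α` of the weight `y_{2α}`, which is `1` unless `m` descends after `α`. -/
def nextFactor (m : ℕ → ℤ) (R : ℕ → ℤ → K) (α : ℕ) : K :=
  if m α = m (α + 1) + 1 then lam R (α + 1) (m (α + 1)) / lam R (α + 1) (m α) else 1

/-- The factor `B_α` of the weight `y_{2α}`, which is `1` unless `m` descends before `α`. -/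
def prevFactor (m : ℕ → ℤ) (R : ℕ → ℤ → K) (α : ℕ) : K :=
  if m (α - 1) = m α + 1 then lam R (α - 1) (m α) / lam R (α - 1) (m (α - 1)) else 1

theorem yEven_eq_mul (m : ℕ → ℤ) (R : ℕ → ℤ → K) (α : ℕ) : yEven m R α =
    mu R (α + 1) (m α + 1) / mu R α (m α) * nextFactor m R α * prevFactor m R α := rfl

theorem IsSolution.nextFactor_self (hR : IsSolution r R) : nextFactor m R r = 1 := by
  simp [nextFactor, hR.lam_right]

theorem IsSolution.prevFactor_one (hR : IsSolution r R) : prevFactor m R 1 = 1 := by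
  simp [prevFactor, hR.lam_left]

theorem IsSolution.nextFactor_mul_moment_sub (hR : IsSolution r R) (hn : Nonvanishing r R)
    (hm : IsMotzkinPath r m) {α : ℕ} (hα : α ≤ r) (k : ℤ) :
    nextFactor m R α * (moment R α (m α) (k + 1) - moment R α (m α + 1) (k + 1)) =
      moment R α (m α) (k + 1) - moment R (α + 1) (m (α + 1)) k -
        yOdd m R (α + 1) * moment R α (m α) k := by
  have hbelow := moment_succ_add_one (R := R) α (k := k)
  have habove := hR.moment_succ_eq hn hα (k := k)
  obtain rfl | rfl | ⟨h1, hlt⟩ : α = r ∨ α = 0 ∨ 1 ≤ α ∧ α + 1 ≤ r := by omega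
  · have htop := hR.moment_top hn (k := k)
    have := hbelow (m α)
    simp only [htop, hR.lam_right] at this
    rw [hR.nextFactor_self, htop, yOdd, Nat.add_sub_cancel, hR.lam_right]
    linear_combination this
  · rw [moment_succ, yOdd]
    simp only [moment_zero, hR.lam_left]
    ring
  · obtain h | h | h : m (α + 1) = m α + 1 ∨ m (α + 1) = m α ∨ m α = m (α + 1) + 1 := by
      have := abs_le.1 (hm α h1 hlt)
      omega
    · rw [nextFactor, if_neg (by omega), yOdd, Nat.add_sub_cancel, h, hbelow]
      ring
    · rw [nextFactor, if_neg (by omega), yOdd, Nat.add_sub_cancel, h, habove]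
      ring
    · have hdrop : moment R α (m (α + 1) + 1) (k + 1) - moment R α (m (α + 1) + 1 + 1) (k + 1) =
          lam R (α + 1) (m (α + 1) + 1) *
            (moment R α (m (α + 1)) k / lam R α (m (α + 1)) -
              moment R α (m (α + 1) + 1) k / lam R α (m (α + 1) + 1)) := by
        linear_combination (hbelow (m (α + 1))).symm.trans (habove (m (α + 1) + 1))
      rw [nextFactor, if_pos h, yOdd, Nat.add_sub_cancel, h, habove, hdrop, ← mul_assoc,
        div_mul_cancel₀ _ (hR.lam_ne_zero hn (by omega) _)]
      ring

theorem IsSolution.lam_div_lam_mul_moment_add (hR : IsSolution r R) (hn : Nonvanishing r R)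
    (hm : IsMotzkinPath r m) {α : ℕ} (hα : α ≤ r) (hdesc : m α = m (α + 1) + 1) (k : ℤ) :
    lam R α (m (α + 1)) / lam R α (m α) * (moment R α (m α) k +
      nextFactor m R α * (moment R α (m α) (k + 1) - moment R α (m α + 1) (k + 1)) /
        yOdd m R (α + 1)) = moment R α (m (α + 1)) k := by
  have hcur := hR.lam_ne_zero hn (α := α) (by omega) (m α)
  have hlow := hR.lam_ne_zero hn (α := α) (by omega) (m (α + 1))
  have hnext := hR.lam_ne_zero hn (α := α + 1) (by omega) (m (α + 1))
  rw [hR.nextFactor_mul_moment_sub hn hm hα, hR.moment_succ_eq hn hα, yOdd, Nat.add_sub_cancel]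
  rw [hdesc] at hcur ⊢
  field_simp
  ring

/-- The paths from `oddNear r m (α + 1)` to the root have more than `depth m α` down-pointing
steps, unless `α = 0`. -/
def depth (m : ℕ → ℤ) : ℕ → ℤ
  | 0 => 0
  | a + 1 => m (a + 1) - m 1 + (a + 1 : ℕ)

theorem depth_of_one_le {α : ℕ} (h1 : 1 ≤ α) : depth m α = m α - m 1 + α := by
  obtain ⟨a, rfl⟩ := Nat.exists_eq_add_of_le' h1
  rfl

theorem depth_succ {α : ℕ} (h1 : 1 ≤ α) :
    depth m (α + 1) = depth m α + (m (α + 1) - m α) + 1 := by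
  rw [depth_of_one_le h1, depth]
  push_cast
  ring

theorem IsMotzkinPath.depth_le_depth_succ (hm : IsMotzkinPath r m) {α : ℕ} (hα : α + 1 ≤ r) :
    depth m α ≤ depth m (α + 1) := by
  rcases Nat.eq_zero_or_pos α with rfl | h1
  · simp [depth]
  · have := abs_le.1 (hm α h1 hα)
    rw [depth_succ h1]
    omega

theorem IsMotzkinPath.one_le_depth (hm : IsMotzkinPath r m) {α : ℕ} (h1 : 1 ≤ α) (hα : α ≤ r) :
    1 ≤ depth m α := by
  induction α, h1 using Nat.le_induction with
  | base => simp [depth]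
  | succ α _ ih => exact (ih (by omega)).trans (hm.depth_le_depth_succ hα)

/-- The value of `R 1 (m 1)` times the partition function of the paths from `oddNear r m (α + 1)`
to the root with `n` down-pointing steps. -/
def upperValue (m : ℕ → ℤ) (R : ℕ → ℤ → K) (α : ℕ) (n : ℤ) : K :=
  if depth m α ≤ n then moment R α (m α) (n + m 1 - α) else 0

theorem upperValue_zero {n : ℤ} (hn : 0 ≤ n) : upperValue m R 0 n = R 1 (n + m 1) := by
  simp [upperValue, depth, hn, moment_zero]

theorem IsSolution.upperValue_eq_zero (hR : IsSolution r R) (hn : Nonvanishing r R) {α : ℕ}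
    (h1 : 1 ≤ α) (hα : α ≤ r + 1) {n : ℤ} (hle : n ≤ depth m α) : upperValue m R α n = 0 := by
  rw [upperValue]
  rw [depth_of_one_le h1] at hle ⊢
  split_ifs
  · exact hR.moment_eq_zero hn hα (by omega) (by omega)
  · rfl

theorem IsSolution.upperValue_eq_moment (hR : IsSolution r R) (hn : Nonvanishing r R) {α : ℕ}
    (h1 : 1 ≤ α) (hα : α ≤ r + 1) {n : ℤ} (hlt : m α - m 1 < n) :
    upperValue m R α n = moment R α (m α) (n + m 1 - α) := by
  rw [upperValue, depth_of_one_le h1]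
  split_ifs
  · rfl
  · exact (hR.moment_eq_zero hn hα (by omega) (by omega)).symm

/-- The value of `R 1 (m 1)` times the weighted sum of the paths from the upper end of the skeleton
edge `2 α` to the root that start with a down-pointing step followed by `n` others. -/
def descentValue (m : ℕ → ℤ) (R : ℕ → ℤ → K) (α : ℕ) (n : ℤ) : K :=
  if depth m α ≤ n then nextFactor m R α * (moment R α (m α) (n + m 1 - α + 1) -
    moment R α (m α + 1) (n + m 1 - α + 1)) else 0

theorem descentValue_zero (n : ℤ) : descentValue m R 0 n = 0 := by
  simp [descentValue, moment_zero]

theorem IsSolution.upperValue_add_one (hR : IsSolution r R) (hn : Nonvanishing r R)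
    (hm : IsMotzkinPath r m) {α : ℕ} (hα : α ≤ r) {n : ℤ} (h0 : 0 ≤ n) :
    upperValue m R α (n + 1) = (if α < r then upperValue m R (α + 1) (n + 1) else 0) +
      yOdd m R (α + 1) * upperValue m R α n + descentValue m R α n := by
  by_cases hdepth : depth m α ≤ n
  · have hnext : (if α < r then upperValue m R (α + 1) (n + 1) else 0) =
        moment R (α + 1) (m (α + 1)) (n + m 1 - α) := by
      split_ifs with hlt
      · rw [hR.upperValue_eq_moment hn (by omega) (by omega)]
        · congr 1
          push_cast
          ring
        · rcases Nat.eq_zero_or_pos α with rfl | h1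
          · simpa using Int.lt_add_one_of_le h0
          · have := abs_le.1 (hm α h1 hlt)
            rw [depth_of_one_le h1] at hdepth
            omega
      · obtain rfl : α = r := by omega
        rw [hR.moment_top hn]
    rw [hnext, upperValue, upperValue, descentValue, if_pos (by omega), if_pos hdepth,
      if_pos hdepth, hR.nextFactor_mul_moment_sub hn hm hα,
      show n + 1 + m 1 - α = n + m 1 - α + 1 by ring]
    ring
  · have h1 : 1 ≤ α := Nat.pos_of_ne_zero fun h => hdepth (by simpa [h, depth] using h0)
    rw [descentValue, if_neg hdepth, hR.upperValue_eq_zero hn h1 (by omega) (by omega),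
      hR.upperValue_eq_zero hn h1 (by omega) (by omega)]
    split_ifs with hlt
    · have := hm.depth_le_depth_succ hlt
      rw [hR.upperValue_eq_zero hn (by omega) (by omega) (by omega)]
      ring
    · ring

/-- The path sums from the vertices `oddNear r m (α + 1)` with `n` down-pointing steps are the
expected ones. -/
def PathSumsEq (r : ℕ) (m : ℕ → ℤ) (R : ℕ → ℤ → K) (n : ℕ) : Prop :=
  ∀ α ≤ r, R 1 (m 1) * pathSum r m R (oddNear r m (α + 1)) n = upperValue m R α n

theorem IsSolution.mul_pathSum_oddFar (hR : IsSolution r R) (hn : Nonvanishing r R)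
    (hm : IsMotzkinPath r m) {a n : ℕ} (ha : a + 1 ≤ r) (hH : ¬Horizontal r m (a + 1))
    (h : ∀ k ≤ n, PathSumsEq r m R k) :
    R 1 (m 1) * pathSum r m R (oddFar r m (a + 1)) n =
      if depth m (a + 1) ≤ n then moment R a (m (a + 1)) (n + m 1 - a) else 0 := by
  cases n with
  | zero =>
    have hroot : oddFar r m (a + 1) ≠ .spine 0 :=
      oddNear_one (r := r) (m := m) ▸ (oddNear_succ_ne_oddFar (Nat.zero_le r) (by omega)).symm
    have hdepth := hm.one_le_depth (α := a + 1) (by omega) ha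
    classical rw [pathSum_zero, if_neg hroot, mul_zero, if_neg (by push_cast; omega)]
  | succ n =>
    rw [pathSum_oddFar_succ R (by omega) (by omega), if_pos ⟨hH, ha⟩, mul_add, mul_left_comm,
      h n (by omega) a (by omega), h (n + 1) le_rfl (a + 1) ha, upperValue.eq_1 m R (a + 1)]
    push_cast
    have hk : (n : ℤ) + 1 + m 1 - (a + 1) = n + m 1 - a := by ring
    have hk' : (n : ℤ) + 1 + m 1 - a = n + m 1 - a + 1 := by ring
    rw [hk, hk']
    rcases Nat.eq_zero_or_pos a with rfl | h1
    · have hdepth : depth m (0 + 1) ≤ (n : ℤ) + 1 := by simp [depth]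
      rw [upperValue_zero n.cast_nonneg, if_pos hdepth, if_pos hdepth, yOdd]
      simp only [moment_succ, moment_zero, hR.lam_left, Nat.add_sub_cancel, Nat.cast_zero, sub_zero]
      ring
    · have hasc : m (a + 1) = m a + 1 := by
        rw [Horizontal, Nat.add_sub_cancel] at hH
        omega
      have hdepth : depth m (a + 1) = depth m a + 2 := by
        rw [depth_succ h1, hasc]
        ring
      rw [hdepth]
      split_ifs with hle
      · rw [upperValue, if_pos (by omega), hasc, moment_succ_add_one, yOdd, Nat.add_sub_cancel,
          hasc]
        ring
      · rw [hR.upperValue_eq_zero hn h1 (by omega) (by omega), mul_zero, add_zero]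

theorem IsSolution.prevFactor_mul_spine_level (hR : IsSolution r R) (hn : Nonvanishing r R)
    (hm : IsMotzkinPath r m) {a n : ℕ} (ha : a + 1 ≤ r) (h : ∀ k ≤ n, PathSumsEq r m R k) :
    prevFactor m R (a + 1) * (R 1 (m 1) * pathSum r m R (.spine (level r m (a + 1))) n +
      if m (a + 1) = m a - 1 then descentValue m R a n / yOdd m R (a + 1) else 0) =
      if depth m (a + 1) ≤ n then moment R a (m (a + 1)) (n + m 1 - a) else 0 := by
  rw [spine_level]
  rcases Nat.eq_zero_or_pos a with rfl | h1
  · have hH : ¬Horizontal r m (0 + 1) := fun h => absurd h.1 (by omega)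
    rw [if_neg hH, hR.mul_pathSum_oddFar hn hm ha hH h, descentValue_zero, zero_div, ite_self,
      add_zero, hR.prevFactor_one, one_mul]
  by_cases hH : Horizontal r m (a + 1)
  · have hstep : m a = m (a + 1) ∨ m a = m (a + 1) + 1 := by
      have := abs_le.1 (hm a h1 ha)
      have := hH.2.2
      rw [Nat.add_sub_cancel] at this
      omega
    rw [if_pos hH, h n le_rfl a (by omega), prevFactor, Nat.add_sub_cancel]
    rcases hstep with hflat | hdesc
    · have hdepth : depth m (a + 1) = depth m a + 1 := by
        rw [depth_succ h1, hflat]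
        ring
      rw [if_neg (by omega), if_neg (by omega), one_mul, add_zero, hdepth]
      split_ifs with hle
      · rw [upperValue, if_pos (by omega), hflat]
      · exact hR.upperValue_eq_zero hn h1 (by omega) (by omega)
    · have hdepth : depth m (a + 1) = depth m a := by
        rw [depth_succ h1, hdesc]
        ring
      rw [if_pos hdesc, if_pos (by omega), hdepth, upperValue, descentValue]
      split_ifs with hle
      · exact hR.lam_div_lam_mul_moment_add hn hm (by omega) hdesc _
      · simp
  · have hasc : m (a + 1) = m a + 1 := by
      rw [Horizontal, Nat.add_sub_cancel] at hH
      omega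
    rw [if_neg hH, hR.mul_pathSum_oddFar hn hm ha hH h, prevFactor, Nat.add_sub_cancel,
      if_neg (by omega), if_neg (show ¬m (a + 1) = m a - 1 by omega), one_mul, add_zero]

theorem IsSolution.mul_descentSum (hR : IsSolution r R) (hn : Nonvanishing r R)
    (hm : IsMotzkinPath r m) {α n : ℕ} (hα : α ≤ r) (h : ∀ k ≤ n, PathSumsEq r m R k) :
    R 1 (m 1) * descentSum m R (fun γ => pathSum r m R (.spine (level r m γ)) n) α =
      descentValue m R α n := by
  induction α with
  | zero => rw [descentSum, descendants_zero, Finset.sum_empty, mul_zero, descentValue_zero]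
  | succ a ih =>
    have hprev := hR.prevFactor_mul_spine_level hn hm hα h
    rw [← ih (by omega)] at hprev
    have hk : (n : ℤ) + m 1 - (a + 1 : ℕ) + 1 = n + m 1 - a := by push_cast; ring
    rw [descentSum_succ, yEven_eq_mul, descentValue, hk, hR.moment_sub_moment_add_one hn hα]
    calc
      _ = mu R (a + 2) (m (a + 1) + 1) / mu R (a + 1) (m (a + 1)) * nextFactor m R (a + 1) *
          (prevFactor m R (a + 1) * (R 1 (m 1) * pathSum r m R (.spine (level r m (a + 1))) n +
            if m (a + 1) = m a - 1 then R 1 (m 1) * descentSum m R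
              (fun γ => pathSum r m R (.spine (level r m γ)) n) a / yOdd m R (a + 1) else 0)) := by
        split_ifs <;> ring
      _ = _ := by
        rw [hprev]
        split_ifs <;> ring

theorem IsSolution.pathSumsEq_zero (hR : IsSolution r R) (hn : Nonvanishing r R)
    (hm : IsMotzkinPath r m) : PathSumsEq r m R 0 := by
  classical
  intro α hα
  rw [pathSum_zero]
  rcases Nat.eq_zero_or_pos α with rfl | h1
  · rw [if_pos oddNear_one, mul_one, Nat.cast_zero, upperValue_zero le_rfl, zero_add]
  · have hdepth := hm.one_le_depth h1 hα
    rw [oddNear_succ h1 hα, if_neg (by simp), mul_zero,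
      hR.upperValue_eq_zero hn h1 (by omega) (by push_cast; omega)]

theorem IsSolution.pathSumsEq_succ (hR : IsSolution r R) (hn : Nonvanishing r R)
    (hm : IsMotzkinPath r m) {n : ℕ} (h : ∀ k ≤ n, PathSumsEq r m R k) :
    PathSumsEq r m R (n + 1) := by
  intro α hα
  have hstep {α} (hα : α ≤ r)
      (hnext : α < r → R 1 (m 1) * pathSum r m R (oddNear r m (α + 2)) (n + 1) =
        upperValue m R (α + 1) (n + 1 : ℕ)) :
      R 1 (m 1) * pathSum r m R (oddNear r m (α + 1)) (n + 1) =
        upperValue m R α (n + 1 : ℕ) := by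
    rw [pathSum_oddNear_succ_succ R hα, mul_add, mul_add, mul_left_comm, h n le_rfl α hα,
      hR.mul_descentSum hn hm hα h, mul_ite, mul_zero, Nat.cast_succ,
      hR.upperValue_add_one hn hm hα (Nat.cast_nonneg n)]
    split_ifs with hlt
    · rw [hnext hlt, Nat.cast_succ]
    · rfl
  induction hα using Nat.decreasingInduction with
  | self => exact hstep le_rfl fun hlt => absurd hlt (lt_irrefl r)
  | of_succ α hlt ih => exact hstep hlt.le fun _ => ih

theorem IsSolution.path_formula (hR : IsSolution r R) (hn : Nonvanishing r R)
    (hm : IsMotzkinPath r m) (n : ℕ) :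
    R 1 (n + m 1) = R 1 (m 1) * pathZ r m R n := by
  have hsums : PathSumsEq r m R n := by
    induction n using Nat.strong_induction_on with
    | _ n ih =>
      cases n with
      | zero => exact hR.pathSumsEq_zero hn hm
      | succ n => exact hR.pathSumsEq_succ hn hm fun k hk => ih k (Nat.lt_succ_of_le hk)
  rw [← upperValue_zero (m := m) (R := R) n.cast_nonneg, ← hsums 0 r.zero_le, oddNear_one]
  rfl

end PathFormula

/-! ### Laurent positivity -/

section Laurent

universe u

/-- A solution without zero members, together with its field of values. Expressions in the members
that make sense for every solution are elements of the ring `∀ S, S.carrier`; an identity in that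
ring is an identity that holds uniformly in the solution. -/
structure NonvanishingSolution (r : ℕ) : Type (u + 1) where
  carrier : Type u
  [field : Field carrier]
  val : ℕ → ℤ → carrier
  isSolution : IsSolution r val
  nonvanishing : Nonvanishing r val

attribute [instance] NonvanishingSolution.field

variable (r : ℕ) (m : ℕ → ℤ)

theorem Nonvanishing.seed_ne_zero {K : Type*} [Field K] {r : ℕ} {R : ℕ → ℤ → K}
    (hn : Nonvanishing r R) (m : ℕ → ℤ) (p : Fin r × Fin 2) : seed r m R p ≠ 0 :=
  hn _ (by omega) (by omega) _

theorem laurentMonomial_add {K : Type*} [Field K] {r : ℕ} {x : Fin r × Fin 2 → K}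
    (hx : ∀ p, x p ≠ 0) (k l : Fin r × Fin 2 → ℤ) :
    laurentMonomial x (k + l) = laurentMonomial x k * laurentMonomial x l := by
  simp only [laurentMonomial, Pi.add_apply, zpow_add₀ (hx _), Finset.prod_mul_distrib]

/-- Laurent monomials in the seed, uniformly in the solution, as a function of the exponent. -/
def seedMonomialHom : Multiplicative (Fin r × Fin 2 → ℤ) →*
    ∀ S : NonvanishingSolution.{u} r, S.carrier where
  toFun k S := laurentMonomial (seed r m S.val) k.toAdd
  map_one' := by ext S; simp [laurentMonomial]
  map_mul' k l := by
    ext S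
    exact laurentMonomial_add (S.nonvanishing.seed_ne_zero m) k.toAdd l.toAdd

/-- Evaluation of Laurent polynomials at the seed, uniformly in the solution. -/
noncomputable def seedEvalHom : PosLaurent r →+ ∀ S : NonvanishingSolution.{u} r, S.carrier where
  toFun P S := P.eval (seed r m S.val)
  map_zero' := by ext S; simp [PosLaurent.eval]
  map_add' P Q := by
    ext S
    exact Finsupp.sum_add_index' (by simp) (by simp [add_mul])

/-- The expressions that are Laurent monomials in the seed, uniformly in the solution. -/
def seedMonomials : Submonoid (∀ S : NonvanishingSolution.{u} r, S.carrier) :=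
  MonoidHom.mrange (seedMonomialHom r m)

/-- The expressions that are Laurent polynomials in the seed with non-negative integer
coefficients, uniformly in the solution. -/
noncomputable def positiveSeedPolynomials :
    AddSubmonoid (∀ S : NonvanishingSolution.{u} r, S.carrier) :=
  AddMonoidHom.mrange (seedEvalHom r m)

variable {r m}

theorem mem_seedMonomials {F : ∀ S : NonvanishingSolution.{u} r, S.carrier} :
    F ∈ seedMonomials r m ↔ ∃ k, ∀ S, F S = laurentMonomial (seed r m S.val) k :=
  exists_congr fun _ => eq_comm.trans funext_iff

theorem mem_positiveSeedPolynomials {F : ∀ S : NonvanishingSolution.{u} r, S.carrier} :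
    F ∈ positiveSeedPolynomials r m ↔ ∃ P : PosLaurent r, ∀ S, F S = P.eval (seed r m S.val) :=
  exists_congr fun _ => eq_comm.trans funext_iff

theorem mem_positiveSeedPolynomials_of_mem_seedMonomials
    {F : ∀ S : NonvanishingSolution.{u} r, S.carrier}
    (hF : F ∈ seedMonomials r m) : F ∈ positiveSeedPolynomials r m := by
  obtain ⟨k, hk⟩ := mem_seedMonomials.1 hF
  refine mem_positiveSeedPolynomials.2 ⟨Finsupp.single k 1, fun S => ?_⟩
  rw [hk S, PosLaurent.eval, Finsupp.sum_single_index (by simp), Nat.cast_one, one_mul]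

theorem div_mem_seedMonomials {F G : ∀ S : NonvanishingSolution.{u} r, S.carrier}
    (hF : F ∈ seedMonomials r m) (hG : G ∈ seedMonomials r m) :
    F / G ∈ seedMonomials r m := by
  obtain ⟨k, hk⟩ := mem_seedMonomials.1 hF
  obtain ⟨l, hl⟩ := mem_seedMonomials.1 hG
  refine mem_seedMonomials.2 ⟨k - l, fun S => ?_⟩
  have hx := S.nonvanishing.seed_ne_zero m
  simp only [Pi.div_apply, hk S, hl S, laurentMonomial, Pi.sub_apply, zpow_sub₀ (hx _),
    Finset.prod_div_distrib]

theorem seed_mem_seedMonomials (p : Fin r × Fin 2) :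
    (fun S : NonvanishingSolution.{u} r => seed r m S.val p) ∈ seedMonomials r m := by
  refine mem_seedMonomials.2 ⟨Pi.single p 1, fun S => ?_⟩
  rw [laurentMonomial, Finset.prod_eq_single p (fun q _ hq => by simp [hq]) (by simp)]
  simp

theorem val_mem_seedMonomials {α : ℕ} (hα : α ≤ r + 1) {n : ℤ} (hn : n = m α ∨ n = m α + 1) :
    (fun S : NonvanishingSolution.{u} r => S.val α n) ∈ seedMonomials r m := by
  obtain rfl | rfl | ⟨a, rfl, ha⟩ : α = 0 ∨ α = r + 1 ∨ ∃ a, α = a + 1 ∧ a < r := by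
    rcases α with _ | a
    · exact .inl rfl
    · exact .inr ((Nat.eq_or_lt_of_le hα).imp id fun h => ⟨a, rfl, by omega⟩)
  · simp only [(NonvanishingSolution.isSolution _).left]
    exact one_mem _
  · simp only [(NonvanishingSolution.isSolution _).right]
    exact one_mem _
  · rcases hn with rfl | rfl
    · simpa only [seed, Fin.val_zero, Nat.cast_zero, add_zero] using
        seed_mem_seedMonomials (m := m) (⟨a, ha⟩, (0 : Fin 2))
    · simpa only [seed, Fin.val_one, Nat.cast_one] using
        seed_mem_seedMonomials (m := m) (⟨a, ha⟩, (1 : Fin 2))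

theorem lam_mem_seedMonomials {α : ℕ} (hα : α ≤ r + 1) :
    (fun S : NonvanishingSolution.{u} r => lam S.val α (m α)) ∈ seedMonomials r m :=
  div_mem_seedMonomials (val_mem_seedMonomials hα (.inr rfl)) (val_mem_seedMonomials hα (.inl rfl))

theorem yOdd_mem_seedMonomials {α : ℕ} (hα : α ≤ r + 1) :
    (fun S : NonvanishingSolution.{u} r => yOdd m S.val α) ∈ seedMonomials r m :=
  div_mem_seedMonomials (lam_mem_seedMonomials hα) (lam_mem_seedMonomials (by omega))

theorem mul_nextFactor_mem_seedMonomials (hm : IsMotzkinPath r m) {α : ℕ}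
    (hα : 1 ≤ α) (hr : α ≤ r) :
    (fun S : NonvanishingSolution.{u} r => S.val (α + 1) (m α + 1) * nextFactor m S.val α) ∈
      seedMonomials r m := by
  obtain rfl | hr := hr.eq_or_lt
  · simp only [(NonvanishingSolution.isSolution _).right,
      (NonvanishingSolution.isSolution _).nextFactor_self, mul_one]
    exact one_mem _
  have hstep := abs_le.1 (hm α hα hr)
  by_cases hd : m α = m (α + 1) + 1
  · convert mul_mem (lam_mem_seedMonomials (m := m) (show α + 1 ≤ r + 1 by omega))
      (val_mem_seedMonomials (show α + 1 ≤ r + 1 by omega) (.inr rfl)) using 1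
    ext S
    have hne := S.isSolution.ne_zero S.nonvanishing (show α + 1 ≤ r + 1 by omega)
    have := hne (m (α + 1)); have := hne (m (α + 1) + 1); have := hne (m (α + 1) + 1 + 1)
    simp only [nextFactor, hd, ↓reduceIte, lam, Pi.mul_apply]
    field_simp
  · simp only [nextFactor, if_neg hd, mul_one]
    exact val_mem_seedMonomials (by omega) (by omega)

theorem mul_prevFactor_mem_seedMonomials (hm : IsMotzkinPath r m) {α : ℕ} (hr : α < r) :
    (fun S : NonvanishingSolution.{u} r => S.val α (m (α + 1)) * prevFactor m S.val (α + 1)) ∈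
      seedMonomials r m := by
  obtain rfl | hα := α.eq_zero_or_pos
  · simp only [(NonvanishingSolution.isSolution _).left,
      (NonvanishingSolution.isSolution _).prevFactor_one, mul_one]
    exact one_mem _
  have hstep := abs_le.1 (hm α hα hr)
  by_cases hd : m α = m (α + 1) + 1
  · convert div_mem_seedMonomials
      (val_mem_seedMonomials (m := m) (show α ≤ r + 1 by omega) (.inl rfl))
      (lam_mem_seedMonomials (show α ≤ r + 1 by omega)) using 1
    ext S
    have hne := S.isSolution.ne_zero S.nonvanishing (show α ≤ r + 1 by omega)
    have := hne (m (α + 1)); have := hne (m (α + 1) + 1); have := hne (m (α + 1) + 1 + 1)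
    simp only [prevFactor, Nat.add_sub_cancel, hd, ↓reduceIte, lam, Pi.div_apply]
    field_simp
  · simp only [prevFactor, Nat.add_sub_cancel, if_neg hd, mul_one]
    exact val_mem_seedMonomials (by omega) (by omega)

theorem yEven_mem_seedMonomials (hm : IsMotzkinPath r m) {α : ℕ} (hα : 1 ≤ α) (hr : α ≤ r) :
    (fun S : NonvanishingSolution.{u} r => yEven m S.val α) ∈ seedMonomials r m := by
  obtain ⟨a, rfl⟩ := Nat.exists_eq_add_of_le' hα
  convert div_mem_seedMonomials
    (mul_mem (mul_nextFactor_mem_seedMonomials hm hα hr) (mul_prevFactor_mem_seedMonomials hm hr))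
    (mul_mem (val_mem_seedMonomials (m := m) (show a + 1 ≤ r + 1 by omega) (.inl rfl))
      (val_mem_seedMonomials (show a + 1 ≤ r + 1 by omega) (.inr rfl))) using 1
  ext S
  simp only [yEven_eq_mul, mu, Nat.add_sub_cancel, div_div_div_eq, Pi.mul_apply, Pi.div_apply]
  ring

theorem weight_mem_seedMonomials (hm : IsMotzkinPath r m) {e : Edge} (he : IsEdge r m e) :
    (fun S : NonvanishingSolution.{u} r => e.weight m S.val) ∈ seedMonomials r m := by
  cases e with
  | oddUp α | evenUp α => exact one_mem _
  | oddDown α => exact yOdd_mem_seedMonomials he.2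
  | evenDown α => exact yEven_mem_seedMonomials hm he.1 he.2
  | extra α β =>
    obtain ⟨hα, -, hβ, -⟩ := he
    convert div_mem_seedMonomials
      (prod_mem (t := Finset.Icc α β) fun γ hγ =>
        yEven_mem_seedMonomials hm (α := γ) (hα.trans (Finset.mem_Icc.1 hγ).1)
        ((Finset.mem_Icc.1 hγ).2.trans hβ))
      (prod_mem (t := Finset.Ioc α β) fun γ hγ => yOdd_mem_seedMonomials (m := m) (α := γ)
        (((Finset.mem_Ioc.1 hγ).2.trans hβ).trans r.le_succ)) using 1
    ext S
    simp only [Edge.weight, Pi.div_apply, Finset.prod_apply]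

theorem finite_rootPaths (r : ℕ) (m : ℕ → ℤ) (n : ℕ) : (rootPaths r m n).Finite :=
  finite_pathsToRoot r m (.spine 0) n

theorem mul_pathZ_mem_positiveSeedPolynomials (hm : IsMotzkinPath r m) (n : ℕ) :
    (fun S : NonvanishingSolution.{u} r => S.val 1 (m 1) * pathZ r m S.val n) ∈
      positiveSeedPolynomials r m := by
  have hsum : (fun S : NonvanishingSolution.{u} r => S.val 1 (m 1) * pathZ r m S.val n) =
      ∑ l ∈ (finite_rootPaths r m n).toFinset,
        (fun S => S.val 1 (m 1)) * (l.map fun e S => e.weight m S.val).prod := by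
    ext S
    simp only [pathZ, finsum_mem_eq_finite_toFinset_sum _ (finite_rootPaths r m n), Finset.mul_sum,
      Finset.sum_apply, Pi.mul_apply, Pi.list_prod_apply, List.map_map, Function.comp_def]
  rw [hsum]
  refine sum_mem fun l hl => mem_positiveSeedPolynomials_of_mem_seedMonomials <|
    mul_mem (val_mem_seedMonomials (by omega) (.inl rfl)) (list_prod_mem fun F hF => ?_)
  obtain ⟨e, he, rfl⟩ := List.mem_map.1 hF
  exact weight_mem_seedMonomials hm (((finite_rootPaths r m n).mem_toFinset.1 hl).1.isEdge e he)

theorem exists_posLaurent_eval_seed_eq (hm : IsMotzkinPath r m) (n : ℕ) :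
    ∃ P : PosLaurent r, ∀ (K : Type u) [Field K] (R : ℕ → ℤ → K),
      IsSolution r R → Nonvanishing r R → R 1 (n + m 1) = P.eval (seed r m R) := by
  obtain ⟨P, hP⟩ := mem_positiveSeedPolynomials.1 (mul_pathZ_mem_positiveSeedPolynomials hm n)
  exact ⟨P, fun K _ R hR hn => (hR.path_formula hn hm n).trans (hP ⟨K, R, hR, hn⟩)⟩

end Laurent

/-! ### The solution with a given seed -/

section Existence

variable {r : ℕ} {m : ℕ → ℤ}

/-- A measure of the distance from `(α, n)` to the seed `x_m`; the `Q`-system relations express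
`R α n` through members that are closer to the seed. -/
def seedDist (r : ℕ) (m : ℕ → ℤ) (α : ℕ) (n : ℤ) : ℕ :=
  if 1 ≤ α ∧ α ≤ r then
    if m α + 1 < n then (n + ∑ β ∈ Finset.Icc 1 r, |m β|).toNat
    else if n < m α then (1 + ∑ β ∈ Finset.Icc 1 r, |m β| - n).toNat
    else 0
  else 0

theorem abs_le_sum_abs (m : ℕ → ℤ) {α : ℕ} (hα : 1 ≤ α) (hr : α ≤ r) :
    |m α| ≤ ∑ β ∈ Finset.Icc 1 r, |m β| :=
  Finset.single_le_sum (f := fun β => |m β|) (fun β _ => abs_nonneg (m β))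
    (Finset.mem_Icc.2 ⟨hα, hr⟩)

theorem seedDist_lt_seedDist_add_one {α β : ℕ} {n k : ℤ} (hα : 1 ≤ α) (hr : α ≤ r) (hn : m α < n)
    (hk : k ≤ n) (hβ : 1 ≤ β → β ≤ r → m β ≤ k) :
    seedDist r m β k < seedDist r m α (n + 1) := by
  have hbound := abs_le.1 (abs_le_sum_abs m hα hr)
  rw [seedDist, seedDist, if_pos (show 1 ≤ α ∧ α ≤ r from ⟨hα, hr⟩),
    if_pos (show m α + 1 < n + 1 by omega)]
  split_ifs <;> omega

theorem seedDist_lt_seedDist_sub_one {α β : ℕ} {n k : ℤ} (hα : 1 ≤ α) (hr : α ≤ r) (hn : n ≤ m α)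
    (hk : n ≤ k) (hβ : 1 ≤ β → β ≤ r → k ≤ m β + 1) :
    seedDist r m β k < seedDist r m α (n - 1) := by
  have hbound := abs_le.1 (abs_le_sum_abs m hα hr)
  rw [seedDist, seedDist, if_pos (show 1 ≤ α ∧ α ≤ r from ⟨hα, hr⟩),
    if_neg (show ¬m α + 1 < n - 1 by omega), if_pos (show n - 1 < m α by omega)]
  split_ifs <;> omega

theorem IsMotzkinPath.abs_sub_pred_le (hm : IsMotzkinPath r m) {α : ℕ} (hα : 1 ≤ α - 1)
    (hr : α ≤ r) : |m (α - 1) - m α| ≤ 1 := by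
  simpa only [show α - 1 + 1 = α by omega] using hm (α - 1) hα (by omega)

theorem IsMotzkinPath.seedDist_neighbours_lt_add_one (hm : IsMotzkinPath r m) {α : ℕ} {n : ℤ}
    (hα : 1 ≤ α) (hr : α ≤ r) (hn : m α < n) :
    seedDist r m α n < seedDist r m α (n + 1) ∧
      seedDist r m (α + 1) n < seedDist r m α (n + 1) ∧
      seedDist r m (α - 1) n < seedDist r m α (n + 1) ∧
      seedDist r m α (n - 1) < seedDist r m α (n + 1) := by
  refine ⟨?_, ?_, ?_, ?_⟩ <;>
    refine seedDist_lt_seedDist_add_one hα hr hn (by omega) fun h1 h2 => ?_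
  · omega
  · linarith [abs_le.1 (hm α hα h2)]
  · have := abs_le.1 (hm.abs_sub_pred_le h1 hr)
    omega
  · omega

theorem IsMotzkinPath.seedDist_neighbours_lt_sub_one (hm : IsMotzkinPath r m) {α : ℕ} {n : ℤ}
    (hα : 1 ≤ α) (hr : α ≤ r) (hn : n ≤ m α) :
    seedDist r m α n < seedDist r m α (n - 1) ∧
      seedDist r m (α + 1) n < seedDist r m α (n - 1) ∧
      seedDist r m (α - 1) n < seedDist r m α (n - 1) ∧
      seedDist r m α (n + 1) < seedDist r m α (n - 1) := by
  refine ⟨?_, ?_, ?_, ?_⟩ <;>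
    refine seedDist_lt_seedDist_sub_one hα hr hn (by omega) fun h1 h2 => ?_
  · omega
  · have := abs_le.1 (hm α hα h2)
    omega
  · have := abs_le.1 (hm.abs_sub_pred_le h1 hr)
    omega
  · omega

theorem IsMotzkinPath.induction_from_seed (hm : IsMotzkinPath r m) {p : ℕ → ℤ → Prop}
    (left : ∀ n, p 0 n) (right : ∀ n, p (r + 1) n)
    (seed : ∀ q : Fin r × Fin 2, p (q.1 + 1) (m (q.1 + 1) + q.2))
    (up : ∀ α, 1 ≤ α → α ≤ r → ∀ n, m α < n →
      p α n → p (α + 1) n → p (α - 1) n → p α (n - 1) → p α (n + 1))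
    (down : ∀ α, 1 ≤ α → α ≤ r → ∀ n, n ≤ m α →
      p α n → p (α + 1) n → p (α - 1) n → p α (n + 1) → p α (n - 1))
    {α : ℕ} (hα : α ≤ r + 1) (n : ℤ) : p α n := by
  induction h : seedDist r m α n using Nat.strong_induction_on generalizing α n with
  | _ d ih =>
  subst h
  obtain rfl | rfl | ⟨h1, hr⟩ : α = 0 ∨ α = r + 1 ∨ 1 ≤ α ∧ α ≤ r := by omega
  · exact left n
  · exact right n
  obtain hn | hn | hn : m α < n - 1 ∨ n + 1 ≤ m α ∨ (m α ≤ n ∧ n ≤ m α + 1) := by omega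
  · obtain ⟨hc, hs, hp, ho⟩ := hm.seedDist_neighbours_lt_add_one h1 hr hn
    rw [sub_add_cancel] at hc hs hp ho
    rw [← sub_add_cancel n 1]
    exact up α h1 hr _ hn (ih _ hc hα _ rfl) (ih _ hs (by omega) _ rfl)
      (ih _ hp (by omega) _ rfl) (ih _ ho hα _ rfl)
  · obtain ⟨hc, hs, hp, ho⟩ := hm.seedDist_neighbours_lt_sub_one h1 hr hn
    rw [add_sub_cancel_right] at hc hs hp ho
    rw [← add_sub_cancel_right n 1]
    exact down α h1 hr _ hn (ih _ hc hα _ rfl) (ih _ hs (by omega) _ rfl)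
      (ih _ hp (by omega) _ rfl) (ih _ ho hα _ rfl)
  · obtain ⟨a, rfl⟩ := Nat.exists_eq_add_of_le' h1
    obtain rfl | rfl : n = m (a + 1) ∨ n = m (a + 1) + 1 := by omega
    · simpa using seed (⟨a, hr⟩, 0)
    · simpa using seed (⟨a, hr⟩, 1)

variable {K : Type*} [Field K] {R R' : ℕ → ℤ → K}

theorem IsSolution.eq_of_seed_eq (hR : IsSolution r R) (hn : Nonvanishing r R)
    (hR' : IsSolution r R') (hm : IsMotzkinPath r m) (hseed : seed r m R' = seed r m R) {α : ℕ}
    (hα : α ≤ r + 1) (n : ℤ) : R' α n = R α n := by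
  refine hm.induction_from_seed (p := fun α n => R' α n = R α n)
    (fun n => (hR'.left n).trans (hR.left n).symm) (fun n => (hR'.right n).trans (hR.right n).symm)
    (congrFun hseed) (fun α h1 hr n _ hc hs hp ho => ?_) (fun α h1 hr n _ hc hs hp ho => ?_) hα n
  · refine mul_right_cancel₀ (hn α h1 hr (n - 1)) ?_
    rw [hR.rel α h1 hr n, ← hc, ← hs, ← hp, ← ho, hR'.rel α h1 hr n]
  · refine mul_left_cancel₀ (hn α h1 hr (n + 1)) ?_
    rw [hR.rel α h1 hr n, ← hc, ← hs, ← hp, ← ho, hR'.rel α h1 hr n]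

/-- The family with seed `x` at the Motzkin path `m` that is computed from the seed by means of the
`Q`-system relations. It is a solution if no division by zero occurs. -/
def ofSeed (hm : IsMotzkinPath r m) (x : Fin r × Fin 2 → K) (α : ℕ) (n : ℤ) : K :=
  if hα : 1 ≤ α ∧ α ≤ r then
    if hup : m α < n - 1 then
      (ofSeed hm x α (n - 1) ^ 2 + ofSeed hm x (α + 1) (n - 1) * ofSeed hm x (α - 1) (n - 1)) /
        ofSeed hm x α (n - 1 - 1)
    else if hdown : n + 1 ≤ m α then
      (ofSeed hm x α (n + 1) ^ 2 + ofSeed hm x (α + 1) (n + 1) * ofSeed hm x (α - 1) (n + 1)) /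
        ofSeed hm x α (n + 1 + 1)
    else x (⟨α - 1, by omega⟩, ⟨(n - m α).toNat, by omega⟩)
  else 1
termination_by seedDist r m α n
decreasing_by
  all_goals first
    | simpa using (hm.seedDist_neighbours_lt_add_one hα.1 hα.2 hup).1
    | simpa using (hm.seedDist_neighbours_lt_add_one hα.1 hα.2 hup).2.1
    | simpa using (hm.seedDist_neighbours_lt_add_one hα.1 hα.2 hup).2.2.1
    | simpa using (hm.seedDist_neighbours_lt_add_one hα.1 hα.2 hup).2.2.2
    | simpa using (hm.seedDist_neighbours_lt_sub_one hα.1 hα.2 hdown).1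
    | simpa using (hm.seedDist_neighbours_lt_sub_one hα.1 hα.2 hdown).2.1
    | simpa using (hm.seedDist_neighbours_lt_sub_one hα.1 hα.2 hdown).2.2.1
    | simpa using (hm.seedDist_neighbours_lt_sub_one hα.1 hα.2 hdown).2.2.2

variable (hm : IsMotzkinPath r m) (x : Fin r × Fin 2 → K)

theorem ofSeed_left (n : ℤ) : ofSeed hm x 0 n = 1 := by
  rw [ofSeed, dif_neg (by omega)]

theorem ofSeed_right (n : ℤ) : ofSeed hm x (r + 1) n = 1 := by
  rw [ofSeed, dif_neg (by omega)]

theorem seed_ofSeed : seed r m (ofSeed hm x) = x := by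
  ext ⟨a, i⟩
  rw [seed, ofSeed, dif_pos (by omega), dif_neg (by omega), dif_neg (by omega)]
  simp

theorem ofSeed_add_one {α : ℕ} (hα : 1 ≤ α) (hr : α ≤ r) {n : ℤ} (hn : m α < n) :
    ofSeed hm x α (n + 1) =
      (ofSeed hm x α n ^ 2 + ofSeed hm x (α + 1) n * ofSeed hm x (α - 1) n) /
        ofSeed hm x α (n - 1) := by
  rw [ofSeed, dif_pos ⟨hα, hr⟩, dif_pos (by omega), add_sub_cancel_right]

theorem ofSeed_sub_one {α : ℕ} (hα : 1 ≤ α) (hr : α ≤ r) {n : ℤ} (hn : n ≤ m α) :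
    ofSeed hm x α (n - 1) =
      (ofSeed hm x α n ^ 2 + ofSeed hm x (α + 1) n * ofSeed hm x (α - 1) n) /
        ofSeed hm x α (n + 1) := by
  rw [ofSeed, dif_pos ⟨hα, hr⟩, dif_neg (by omega), dif_pos (by omega), sub_add_cancel]

theorem Nonvanishing.isSolution_ofSeed {hm : IsMotzkinPath r m} {x : Fin r × Fin 2 → K}
    (hn : Nonvanishing r (ofSeed hm x)) : IsSolution r (ofSeed hm x) where
  left := ofSeed_left hm x
  right := ofSeed_right hm x
  rel α h1 hr n := by
    obtain h | h := lt_or_ge (m α) n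
    · rw [ofSeed_add_one hm x h1 hr h, div_mul_cancel₀ _ (hn α h1 hr _)]
    · rw [ofSeed_sub_one hm x h1 hr h, mul_div_cancel₀ _ (hn α h1 hr _)]

end Existence

section PositiveFraction

variable {A k F : Type*} [CommRing A] [CommRing k] [PartialOrder k] [Field F] [Algebra A F]
  {φ : A →+* k} {x y z w : F}

/-- `x` is a fraction whose numerator and denominator are positive under the homomorphism `φ`.
The fractions with this property are nonzero and closed under subtraction-free operations. -/
def IsPositiveFraction (φ : A →+* k) (x : F) : Prop :=
  ∃ p q : A, 0 < φ p ∧ 0 < φ q ∧ x = algebraMap A F p / algebraMap A F q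

theorem algebraMap_ne_zero_of_map_pos [IsFractionRing A F] {p : A} (hp : 0 < φ p) :
    algebraMap A F p ≠ 0 := by
  refine (map_ne_zero_iff _ (IsFractionRing.injective A F)).2 ?_
  rintro rfl
  exact hp.ne' (map_zero φ)

theorem IsPositiveFraction.ne_zero [IsFractionRing A F] (hx : IsPositiveFraction φ x) : x ≠ 0 := by
  obtain ⟨p, q, hp, hq, rfl⟩ := hx
  exact div_ne_zero (algebraMap_ne_zero_of_map_pos hp) (algebraMap_ne_zero_of_map_pos hq)

theorem IsPositiveFraction.inv (hx : IsPositiveFraction φ x) : IsPositiveFraction φ x⁻¹ := by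
  obtain ⟨p, q, hp, hq, rfl⟩ := hx
  exact ⟨q, p, hq, hp, inv_div _ _⟩

variable [IsStrictOrderedRing k]

theorem isPositiveFraction_algebraMap {p : A} (hp : 0 < φ p) :
    IsPositiveFraction φ (algebraMap A F p) :=
  ⟨p, 1, hp, by simp, by simp⟩

theorem isPositiveFraction_one : IsPositiveFraction φ (1 : F) := by
  simpa using isPositiveFraction_algebraMap (F := F) (φ := φ) (p := 1) (by simp)

theorem IsPositiveFraction.mul (hx : IsPositiveFraction φ x) (hy : IsPositiveFraction φ y) :
    IsPositiveFraction φ (x * y) := by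
  obtain ⟨p, q, hp, hq, rfl⟩ := hx
  obtain ⟨p', q', hp', hq', rfl⟩ := hy
  exact ⟨p * p', q * q', by rw [map_mul]; positivity, by rw [map_mul]; positivity,
    by simp only [map_mul, div_mul_div_comm]⟩

variable [IsFractionRing A F]

theorem IsPositiveFraction.add (hx : IsPositiveFraction φ x) (hy : IsPositiveFraction φ y) :
    IsPositiveFraction φ (x + y) := by
  obtain ⟨p, q, hp, hq, rfl⟩ := hx
  obtain ⟨p', q', hp', hq', rfl⟩ := hy
  refine ⟨p * q' + q * p', q * q', ?_, ?_, ?_⟩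
  · simp only [map_add, map_mul]
    positivity
  · rw [map_mul]
    positivity
  · rw [div_add_div _ _ (algebraMap_ne_zero_of_map_pos hq) (algebraMap_ne_zero_of_map_pos hq')]
    simp only [map_add, map_mul]

theorem IsPositiveFraction.sq_add_mul_div (hx : IsPositiveFraction φ x)
    (hy : IsPositiveFraction φ y) (hz : IsPositiveFraction φ z) (hw : IsPositiveFraction φ w) :
    IsPositiveFraction φ ((x ^ 2 + y * z) / w) := by
  rw [sq, div_eq_mul_inv]
  exact ((hx.mul hx).add (hy.mul hz)).mul hw.inv

theorem IsPositiveFraction.ofSeed {r : ℕ} {m : ℕ → ℤ} (hm : IsMotzkinPath r m)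
    {x : Fin r × Fin 2 → F} (hx : ∀ p, IsPositiveFraction φ (x p)) {α : ℕ} (hα : α ≤ r + 1)
    (n : ℤ) : IsPositiveFraction φ (ofSeed hm x α n) := by
  refine hm.induction_from_seed (p := fun α n => IsPositiveFraction φ (QSystem.ofSeed hm x α n))
    (fun n => ?_) (fun n => ?_) (fun q => ?_) (fun α h1 hr n h hc hs hp ho => ?_)
    (fun α h1 hr n h hc hs hp ho => ?_) hα n
  · exact ofSeed_left hm x n ▸ isPositiveFraction_one
  · exact ofSeed_right hm x n ▸ isPositiveFraction_one
  · change IsPositiveFraction φ (seed r m (QSystem.ofSeed hm x) q)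
    exact (seed_ofSeed hm x).symm ▸ hx q
  · exact ofSeed_add_one hm x h1 hr h ▸ hc.sq_add_mul_div hs hp ho
  · exact ofSeed_sub_one hm x h1 hr h ▸ hc.sq_add_mul_div hs hp ho

end PositiveFraction

theorem isPositiveFraction_seedVar {r : ℕ} (p : Fin r × Fin 2) :
    IsPositiveFraction (MvPolynomial.eval fun _ : Fin r × Fin 2 => (1 : ℚ)) (seedVar r p) :=
  isPositiveFraction_algebraMap (by simp)

theorem nonvanishing_ofSeed_seedVar {r : ℕ} {m : ℕ → ℤ} (hm : IsMotzkinPath r m) :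
    Nonvanishing r (ofSeed hm (seedVar r)) := fun _ _ hr _ =>
  (IsPositiveFraction.ofSeed hm isPositiveFraction_seedVar (hr.trans r.le_succ) _).ne_zero

theorem exists_unique_solution_seed_eq_seedVar {r : ℕ} {m : ℕ → ℤ} (hm : IsMotzkinPath r m) :
    ∃ R : ℕ → ℤ → SeedField r, IsSolution r R ∧ Nonvanishing r R ∧ seed r m R = seedVar r ∧
      ∀ R' : ℕ → ℤ → SeedField r, IsSolution r R' → seed r m R' = seedVar r →
        ∀ α ≤ r + 1, ∀ n : ℤ, R' α n = R α n := by
  have hn := nonvanishing_ofSeed_seedVar hm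
  have hseed := seed_ofSeed hm (seedVar r)
  exact ⟨_, hn.isSolution_ofSeed, hn, hseed, fun R' hR' hseed' α hα n =>
    hn.isSolution_ofSeed.eq_of_seed_eq hn hR' hm (hseed'.trans hseed.symm) hα n⟩

end QSystem

theorem mainTheorem2_general (r : ℕ) (m : ℕ → ℤ) (hm : QSystem.IsMotzkinPath r m) :
    (∃ R : ℕ → ℤ → QSystem.SeedField r,
      QSystem.IsSolution r R ∧ QSystem.Nonvanishing r R ∧
      QSystem.seed r m R = QSystem.seedVar r ∧
      ∀ R' : ℕ → ℤ → QSystem.SeedField r, QSystem.IsSolution r R' →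
        QSystem.seed r m R' = QSystem.seedVar r →
        ∀ α ≤ r + 1, ∀ n : ℤ, R' α n = R α n) ∧
    (∀ n : ℕ, (QSystem.rootPaths r m n).Finite) ∧
    (∀ e : QSystem.Edge, QSystem.IsEdge r m e → ∃ k : Fin r × Fin 2 → ℤ,
      ∀ (K : Type*) [Field K] (R : ℕ → ℤ → K),
        QSystem.IsSolution r R → QSystem.Nonvanishing r R →
        e.weight m R = QSystem.laurentMonomial (QSystem.seed r m R) k) ∧
    ∀ n : ℕ, ∃ P : QSystem.PosLaurent r,
      ∀ (K : Type*) [Field K] (R : ℕ → ℤ → K),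
        QSystem.IsSolution r R → QSystem.Nonvanishing r R →
        R 1 ((n : ℤ) + m 1) = R 1 (m 1) * QSystem.pathZ r m R n ∧
        R 1 ((n : ℤ) + m 1) = P.eval (QSystem.seed r m R) := by
  refine ⟨QSystem.exists_unique_solution_seed_eq_seedVar hm, QSystem.finite_rootPaths r m,
    fun e he => ?_, fun n => ?_⟩
  · obtain ⟨k, hk⟩ := QSystem.mem_seedMonomials.1 (QSystem.weight_mem_seedMonomials hm he)
    exact ⟨k, fun K _ R hR hn => hk ⟨K, R, hR, hn⟩⟩
  · obtain ⟨P, hP⟩ := QSystem.exists_posLaurent_eval_seed_eq hm n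
    exact ⟨P, fun K _ R hR hn => ⟨hR.path_formula hn hm n, hP K R hR hn⟩⟩

theorem mainTheorem2 (r : ℕ) (m : ℕ → ℤ) (hm : QSystem.InFundamentalDomain r m) :
    -- there is exactly one solution whose seed `x_m` consists of `2 r` indeterminates
    -- (its entries are the functional forms `(R_{α,n})_m`), and none of its entries vanishes
    (∃ R : ℕ → ℤ → QSystem.SeedField r,
      QSystem.IsSolution r R ∧ QSystem.Nonvanishing r R ∧
      QSystem.seed r m R = QSystem.seedVar r ∧
      ∀ R' : ℕ → ℤ → QSystem.SeedField r, QSystem.IsSolution r R' →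
        QSystem.seed r m R' = QSystem.seedVar r →
        ∀ α ≤ r + 1, ∀ n : ℤ, R' α n = R α n) ∧
    -- there are finitely many paths from the root to itself with `n` down-pointing steps
    (∀ n : ℕ, (QSystem.rootPaths r m n).Finite) ∧
    -- the edge weights are Laurent monomials (with coefficient 1) in the seed `x_m`
    (∀ e : QSystem.Edge, QSystem.IsEdge r m e → ∃ k : Fin r × Fin 2 → ℤ,
      ∀ (K : Type*) [Field K] (R : ℕ → ℤ → K),
        QSystem.IsSolution r R → QSystem.Nonvanishing r R →
        e.weight m R = QSystem.laurentMonomial (QSystem.seed r m R) k) ∧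
    -- the path formula, and positivity
    ∀ n : ℕ, ∃ P : QSystem.PosLaurent r,
      ∀ (K : Type*) [Field K] (R : ℕ → ℤ → K),
        QSystem.IsSolution r R → QSystem.Nonvanishing r R →
        R 1 ((n : ℤ) + m 1) = R 1 (m 1) * QSystem.pathZ r m R n ∧
        R 1 ((n : ℤ) + m 1) = P.eval (QSystem.seed r m R) := by
  exact mainTheorem2_general r m hm.motzkin
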